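/- Let $K\subset\mathbb R^2$ be a convex body (a nonempty compact convex set), and let $\mathcal F_1,\mathcal F_2$ be finite families of translates of $K$ such that $A\cap B\neq\emptyset$ for every $A\in\mathcal F_1$ and every $B\in\mathcal F_2$. Suppose that at least one of the following holds: (i) $K$ has constant width, that is, $\max_{x\in K}\langle u,x\rangle-\min_{x\in K}\langle u,x\rangle$ is the same for all unit vectors $u\in\mathbb R^2$; (ii) the Banach–Mazur distance between $K$ and the closed unit disk $D$ is at most $1.1178$. Here this distance is the infimum of all $c\ge 1$ for which there are an invertible affine map $T:\mathbb R^2\to\mathbb R^2$ and a point $y\in\mathbb R^2$ with $D\subseteq T(K)\subseteq y+c\,(D-y)$ (and $+\infty$ if there is no such $c$). Then at least one of the families $\mathcal F_1,\mathcal F_2$ can be pierced by $3$ points, that is, there are $j\in\{1,2\}$ and a set of at most three points of $\mathbb R^2$ that meets every member of $\mathcal F_j$. -/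

import Mathlib

open scoped RealInnerProductSpace Pointwise

/-- The Euclidean plane. -/
abbrev Plane : Type := EuclideanSpace ℝ (Fin 2)

/-- The width of `K` in direction `u`: the distance between the two supporting lines of `K`
orthogonal to the unit vector `u`. -/
noncomputable def widthIn (K : Set Plane) (u : Plane) : ℝ :=
  sSup ((fun x => ⟪u, x⟫) '' K) - sInf ((fun x => ⟪u, x⟫) '' K)

/-- `K` has the same width in every direction. -/
def HasConstantWidth (K : Set Plane) : Prop :=
  ∃ w : ℝ, ∀ u : Plane, ‖u‖ = 1 → widthIn K u = w

/-- The Banach-Mazur distance of (not necessarily symmetric) convex bodies: the infimum of the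
ratios `c ≥ 1` such that some invertible affine image of `K` lies between `L` and a homothetic
copy of `L` of ratio `c`. It is `⊤` if there is no such `c`. -/
noncomputable def banachMazurDist (K L : Set Plane) : ENNReal :=
  ⨅ (c : ℝ) (_ : 1 ≤ c ∧ ∃ (T : Plane ≃ᵃ[ℝ] Plane) (y : Plane),
    L ⊆ T '' K ∧ T '' K ⊆ AffineMap.homothety y c '' L), ENNReal.ofReal c

/-- The closed unit disk. -/
def unitDisk : Set Plane := Metric.closedBall 0 1

/-- `F` is a family of translates of `K`. -/
def IsFamilyOfTranslates (F : Set (Set Plane)) (K : Set Plane) : Prop :=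
  ∀ A ∈ F, ∃ x : Plane, A = x +ᵥ K

/-- `F` can be pierced by `n` points: some set of at most `n` points meets every member of `F`. -/
def CanBePierced (F : Set (Set Plane)) (n : ℕ) : Prop :=
  ∃ S : Finset Plane, S.card ≤ n ∧ ∀ A ∈ F, ∃ p ∈ S, p ∈ A

/-!
Translates `x + K` and `y + K` meet exactly when `x - y ∈ K - K`, and `x + K` contains `p` exactly
when `p - x ∈ K`. So there are two finite sets `X`, `Y` of translation vectors with
`X - Y ⊆ K - K`, and one of them has to be covered by three translates of `-K`. If `K` has constant
width `R`, then `‖x - y‖ ≤ R` for `x ∈ X`, `y ∈ Y`. In the second case, after an affine map, `K`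
contains the unit disk and has diameter at most `2 * 1.118 ≤ √5 = R`, so that `K` contains a disk of
radius `R / √5`.

*Hexagons* (`exists_concentric_hexagons`). Let `h` and `k` be the support functions of `X` and `Y`
and `g u = (h u - k (-u)) / 2`. Since `h u + k (-u) ≤ R`, we have `h u ≤ R / 2 + g u` and
`k u ≤ R / 2 - g (-u)`. A half-turn changes the sign of the sum of the odd part of `g` over three
unit vectors `u 0, u 1, u 2` of sum zero, so for some position of the three vectors this sum
vanishes. Then the odd parts are the coordinates of a point `p`, and, with `e j` the even part of
`g` at `u j`, the sets `X` and `Y` lie in the hexagons about `p` with half-widths `R / 2 + e j` and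
`R / 2 - e j`. One of the two hexagons has half-widths of sum at most `3 R / 2`.

*Covering a hexagon* (`exists_cover_of_antitone`). Let `R = 1`. It remains to cover every hexagon
with half-widths `b₀ ≥ b₁ ≥ b₂` of sum at most `3 / 2` by three translates of `-K`, or of `K`, since
the hexagon is centrally symmetric. Cut it from an interior point into three pieces, with all points
depending affinely on `b` over a triangle of parameters. The property that a piece has a translate
inside a convex set passes to convex combinations of pieces (`HexStar.comb_fits`), so it need only
be checked at the corners of the parameter triangle. Three parameter triangles, with five corners and two ways of cutting, suffice,
and at the corners the check is arithmetic with rational numbers.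

*Pieces* (`HexStar.IsSmall`). At the corners every piece lies in a disk of radius `1 / √5`, which
settles the second case, and also in a stadium, the sum of a segment of length `a` and a disk of
radius `0.4226 (1 - a)`. A body of constant width `1` contains a translate of each such stadium: it
has chords of length `1` in all directions (`exists_chord`), it contains a disk of radius
`1 - 1 / √3 > 0.4226` by Jung's theorem (`exists_closedBall_subset`), and it is convex.
-/

/-! ### Jung's theorem in the plane -/

/-- At most three points with pairwise distances at most `d` lie in a disk of radius `d / √3`.
The centre is the barycentre for weights maximising the moment of inertia
`∑ λᵢ ‖cᵢ‖² - ‖∑ λᵢ cᵢ‖²`; optimality in the direction of the `k`-th vertex of the simplex bounds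
the distance from `c k` to the centre by the maximum. -/
theorem exists_center_of_card_le_three {ι E : Type*} [Fintype ι] [Nonempty ι]
    [NormedAddCommGroup E] [InnerProductSpace ℝ E] (hι : Fintype.card ι ≤ 3) (c : ι → E) {d : ℝ}
    (hd : ∀ i j, ‖c i - c j‖ ≤ d) : ∃ z, ∀ i, ‖c i - z‖ ^ 2 ≤ d ^ 2 / 3 := by
  classical
  set f : (ι → ℝ) → ℝ := fun l => ∑ i, l i * ‖c i‖ ^ 2 - ‖∑ i, l i • c i‖ ^ 2 with hf
  have hfc : Continuous f := by fun_prop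
  obtain ⟨l, hl, hmax⟩ := (isCompact_stdSimplex ℝ ι).exists_isMaxOn
    ⟨_, single_mem_stdSimplex ℝ (Classical.arbitrary ι)⟩ hfc.continuousOn
  obtain ⟨hl0, hl1⟩ := hl
  set z := ∑ i, l i • c i with hz
  have hfl : f l = ∑ i, l i * ‖c i‖ ^ 2 - ‖z‖ ^ 2 := rfl
  have key : ∀ k, ‖c k - z‖ ^ 2 ≤ f l := by
    intro k
    have hstep : ∀ t : ℝ, 0 < t → t ≤ 1 → (1 - t) * ‖c k - z‖ ^ 2 ≤ f l := by
      intro t ht ht1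
      have hmem : (1 - t) • l + t • (Pi.single k 1 : ι → ℝ) ∈ stdSimplex ℝ ι :=
        convex_stdSimplex ℝ ι ⟨hl0, hl1⟩ (single_mem_stdSimplex ℝ k) (by linarith) ht.le (by ring)
      have h1 := hmax hmem
      have h2 : f ((1 - t) • l + t • (Pi.single k 1 : ι → ℝ)) =
          (1 - t) * f l + t * (1 - t) * ‖c k - z‖ ^ 2 := by
        have e1 : ∑ i, ((1 - t) • l + t • (Pi.single k 1 : ι → ℝ)) i * ‖c i‖ ^ 2 =
            (1 - t) * ∑ i, l i * ‖c i‖ ^ 2 + t * ‖c k‖ ^ 2 := by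
          simp [add_mul, Finset.sum_add_distrib, Finset.mul_sum, mul_assoc, Pi.single_apply]
        have e2 : ∑ i, ((1 - t) • l + t • (Pi.single k 1 : ι → ℝ)) i • c i =
            (1 - t) • z + t • c k := by
          simp [add_smul, Finset.sum_add_distrib, Finset.smul_sum, smul_smul, Pi.single_apply, hz]
        have e3 : ‖(1 - t) • z + t • c k‖ ^ 2 =
            (1 - t) * ‖z‖ ^ 2 + t * ‖c k‖ ^ 2 - t * (1 - t) * ‖c k - z‖ ^ 2 := by
          rw [norm_add_sq_real, norm_sub_sq_real, norm_smul, norm_smul, inner_smul_left,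
            inner_smul_right, mul_pow, mul_pow, Real.norm_eq_abs, Real.norm_eq_abs, sq_abs, sq_abs,
            real_inner_comm z (c k)]
          simp only [conj_trivial]
          ring
        rw [hfl]
        simp only [hf]
        rw [e1, e2, e3]
        ring
      have h3 : f ((1 - t) • l + t • (Pi.single k 1 : ι → ℝ)) ≤ f l := h1
      rw [h2] at h3
      have : t * ((1 - t) * ‖c k - z‖ ^ 2) ≤ t * f l := by linarith
      exact le_of_mul_le_mul_left this ht
    have hlim : Filter.Tendsto (fun t : ℝ => (1 - t) * ‖c k - z‖ ^ 2) (nhdsWithin 0 (Set.Ioi 0))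
        (nhds ((1 - 0) * ‖c k - z‖ ^ 2)) :=
      (Continuous.tendsto (by fun_prop) 0).mono_left nhdsWithin_le_nhds
    have := le_of_tendsto hlim (b := f l) (by
      filter_upwards [Ioo_mem_nhdsGT (zero_lt_one' ℝ)] with t ht using hstep t ht.1 ht.2.le)
    simpa using this
  -- The parallel axis identity for the point `c i`, estimated with the pairwise distances.
  have hpar : ∀ i, ‖c i - z‖ ^ 2 + f l ≤ (1 - l i) * d ^ 2 := by
    intro i
    have e1 : ‖c i - z‖ ^ 2 + f l = ∑ j, l j * ‖c i - c j‖ ^ 2 := by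
      have : ∀ j, l j * ‖c i - c j‖ ^ 2 =
          l j * ‖c i‖ ^ 2 - 2 * ⟪c i, l j • c j⟫ + l j * ‖c j‖ ^ 2 := by
        intro j
        rw [norm_sub_sq_real, inner_smul_right]
        ring
      simp only [this]
      rw [Finset.sum_add_distrib, Finset.sum_sub_distrib, ← Finset.sum_mul, ← Finset.mul_sum,
        ← inner_sum, hl1, ← hz, hfl, norm_sub_sq_real]
      ring
    rw [e1]
    have e2 : ∀ j, l j * ‖c i - c j‖ ^ 2 ≤ (l j - if j = i then l i else 0) * d ^ 2 := by
      intro j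
      by_cases h : j = i
      · subst h; simp
      · have := hd i j
        have h2 : ‖c i - c j‖ ^ 2 ≤ d ^ 2 := by gcongr
        simpa [h] using mul_le_mul_of_nonneg_left h2 (hl0 j)
    refine (Finset.sum_le_sum fun j _ => e2 j).trans ?_
    rw [← Finset.sum_mul, Finset.sum_sub_distrib, hl1]
    simp
  have hsum : 2 * f l ≤ (1 - ∑ i, l i ^ 2) * d ^ 2 := by
    have h1 : ∑ i, l i * (‖c i - z‖ ^ 2 + f l) ≤ ∑ i, l i * ((1 - l i) * d ^ 2) :=
      Finset.sum_le_sum fun i _ => mul_le_mul_of_nonneg_left (hpar i) (hl0 i)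
    have h2 : ∑ i, l i * ‖c i - z‖ ^ 2 = f l := by
      have : ∀ i, l i * ‖c i - z‖ ^ 2 =
          l i * ‖c i‖ ^ 2 - 2 * ⟪l i • c i, z⟫ + l i * ‖z‖ ^ 2 := by
        intro i
        rw [norm_sub_sq_real, inner_smul_left]
        simp only [conj_trivial]
        ring
      simp only [this]
      rw [Finset.sum_add_distrib, Finset.sum_sub_distrib, ← Finset.sum_mul, ← Finset.mul_sum,
        ← sum_inner, hl1, ← hz, hfl, real_inner_self_eq_norm_sq]
      ring
    have h3 : ∑ i, l i * (‖c i - z‖ ^ 2 + f l) = 2 * f l := by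
      simp only [mul_add]
      rw [Finset.sum_add_distrib, h2, ← Finset.sum_mul, hl1]
      ring
    have h4 : ∑ i, l i * ((1 - l i) * d ^ 2) = (1 - ∑ i, l i ^ 2) * d ^ 2 := by
      rw [← hl1, ← Finset.sum_sub_distrib, Finset.sum_mul]
      exact Finset.sum_congr rfl fun i _ => by rw [hl1]; ring
    linarith
  have hsq : 1 ≤ 3 * ∑ i, l i ^ 2 := by
    have h1 := sq_sum_le_card_mul_sum_sq (s := Finset.univ) (f := l)
    rw [hl1] at h1
    have h2 : ((Finset.univ : Finset ι).card : ℝ) ≤ 3 := by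
      rw [Finset.card_univ]; exact_mod_cast hι
    have h3 : 0 ≤ ∑ i, l i ^ 2 := Finset.sum_nonneg fun i _ => sq_nonneg _
    nlinarith
  refine ⟨z, fun i => (key i).trans ?_⟩
  nlinarith [sq_nonneg d]

/-- **Jung's theorem** in the plane. -/
theorem exists_center_of_dist_le {K : Set Plane} {d : ℝ}
    (hd : ∀ x ∈ K, ∀ y ∈ K, ‖x - y‖ ≤ d) : ∃ z, ∀ x ∈ K, ‖x - z‖ ≤ d / √3 := by
  have h := Convex.helly_theorem_compact' (𝕜 := ℝ) (E := Plane)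
    (F := fun x : K => Metric.closedBall (x : Plane) (d / √3))
    (fun x => convex_closedBall _ _) (fun x => isCompact_closedBall _ _) (by
      intro I hI
      rcases I.eq_empty_or_nonempty with rfl | hne
      · simp
      have : Nonempty I := hne.to_subtype
      have hfr : Module.finrank ℝ Plane = 2 := by simp
      rw [hfr] at hI
      have hd0 : 0 ≤ d := by
        obtain ⟨x, -⟩ := hne
        exact (norm_nonneg _).trans (hd x x.2 x x.2)
      obtain ⟨z, hz⟩ := exists_center_of_card_le_three (ι := I) (by simpa using hI)
        (fun i => ((i : K) : Plane)) (fun i j => hd _ i.1.2 _ j.1.2)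
      refine ⟨z, Set.mem_iInter₂.2 fun x hx => ?_⟩
      rw [Metric.mem_closedBall, dist_eq_norm, norm_sub_rev]
      have h1 := hz ⟨x, hx⟩
      refine le_of_sq_le_sq ?_ (by positivity)
      rw [div_pow, Real.sq_sqrt (by norm_num)]
      exact h1)
  obtain ⟨z, hz⟩ := h
  refine ⟨z, fun x hx => ?_⟩
  have := Set.mem_iInter.1 hz ⟨x, hx⟩
  rwa [Metric.mem_closedBall, dist_eq_norm, norm_sub_rev] at this

/-! ### Bodies of constant width -/

section ConstantWidth

variable {K : Set Plane} {w : ℝ}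

/-- The width is attained at two contact points with supporting lines. -/
theorem exists_isMinOn_isMaxOn_inner (hKc : IsCompact K) (hKn : K.Nonempty) (u : Plane) :
    ∃ a ∈ K, ∃ b ∈ K, (∀ x ∈ K, ⟪u, a⟫ ≤ ⟪u, x⟫ ∧ ⟪u, x⟫ ≤ ⟪u, b⟫) ∧
      widthIn K u = ⟪u, b⟫ - ⟪u, a⟫ := by
  have hc : ContinuousOn (fun x : Plane => ⟪u, x⟫) K := by fun_prop
  obtain ⟨a, ha, hamin⟩ := hKc.exists_isMinOn hKn hc
  obtain ⟨b, hb, hbmax⟩ := hKc.exists_isMaxOn hKn hc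
  refine ⟨a, ha, b, hb, fun x hx => ⟨hamin hx, hbmax hx⟩, ?_⟩
  have h1 : IsGreatest ((fun x => ⟪u, x⟫) '' K) ⟪u, b⟫ :=
    ⟨⟨b, hb, rfl⟩, by rintro _ ⟨x, hx, rfl⟩; exact hbmax hx⟩
  have h2 : IsLeast ((fun x => ⟪u, x⟫) '' K) ⟪u, a⟫ :=
    ⟨⟨a, ha, rfl⟩, by rintro _ ⟨x, hx, rfl⟩; exact hamin hx⟩
  rw [widthIn, h1.csSup_eq, h2.csInf_eq]

/-- The distance of two points is the width of the pair in the direction of their difference. -/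
theorem norm_sub_le_of_widthIn (hKc : IsCompact K) (hw : ∀ u : Plane, ‖u‖ = 1 → widthIn K u = w)
    {x y : Plane} (hx : x ∈ K) (hy : y ∈ K) (hw0 : 0 ≤ w) : ‖x - y‖ ≤ w := by
  by_cases h : x - y = 0
  · simpa [h] using hw0
  have hn : 0 < ‖x - y‖ := norm_pos_iff.2 h
  set u := ‖x - y‖⁻¹ • (x - y) with hu
  have hu1 : ‖u‖ = 1 := norm_smul_inv_norm (𝕜 := ℝ) h
  obtain ⟨a, -, b, -, hab, hwid⟩ := exists_isMinOn_isMaxOn_inner hKc ⟨x, hx⟩ u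
  have h1 : ⟪u, x - y⟫ = ‖x - y‖ := by
    rw [hu, inner_smul_left, real_inner_self_eq_norm_sq]
    simp only [conj_trivial]
    field_simp
  rw [inner_sub_right] at h1
  have := hw u hu1
  linarith [(hab x hx).2, (hab y hy).1]

theorem width_nonneg (hKc : IsCompact K) (hKn : K.Nonempty)
    (hw : ∀ u : Plane, ‖u‖ = 1 → widthIn K u = w) : 0 ≤ w := by
  obtain ⟨u, hu⟩ := exists_norm_eq Plane (zero_le_one' ℝ)
  obtain ⟨a, ha, b, hb, hab, hwid⟩ := exists_isMinOn_isMaxOn_inner hKc hKn u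
  have := (hab a ha).2
  linarith [hw u hu]

/-- A body of constant width `w` contains a translate of every segment of length at most `w`:
the chord joining the contact points with the two supporting lines orthogonal to the segment
has length `w`. -/
theorem exists_chord (hKc : IsCompact K) (hKn : K.Nonempty) (hconv : Convex ℝ K)
    (hw : ∀ u : Plane, ‖u‖ = 1 → widthIn K u = w) {v : Plane} (hv : ‖v‖ ≤ w) :
    ∃ a ∈ K, a + v ∈ K := by
  by_cases h : v = 0
  · obtain ⟨a, ha⟩ := hKn
    exact ⟨a, ha, by simpa [h] using ha⟩
  have hn : 0 < ‖v‖ := norm_pos_iff.2 h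
  set u := ‖v‖⁻¹ • v with hu
  have hu1 : ‖u‖ = 1 := norm_smul_inv_norm (𝕜 := ℝ) h
  obtain ⟨a, ha, b, hb, hab, hwid⟩ := exists_isMinOn_isMaxOn_inner hKc hKn u
  have hw0 : 0 < w := hn.trans_le hv
  have hle := norm_sub_le_of_widthIn hKc hw hb ha hw0.le
  have hin : ⟪u, b - a⟫ = w := by rw [inner_sub_right, ← hwid, hw u hu1]
  have hba : b - a = w • u := by
    have h0 : ‖(b - a) - w • u‖ ^ 2 ≤ 0 := by
      rw [norm_sub_sq_real, inner_smul_right, real_inner_comm, hin, norm_smul, hu1,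
        Real.norm_eq_abs, mul_one, sq_abs]
      nlinarith [norm_nonneg (b - a)]
    have : ‖(b - a) - w • u‖ = 0 := by nlinarith [norm_nonneg ((b - a) - w • u)]
    exact sub_eq_zero.1 (norm_eq_zero.1 this)
  refine ⟨a, ha, ?_⟩
  have hvb : a + v = (1 - ‖v‖ / w) • a + (‖v‖ / w) • b := by
    have hb' : b = a + w • u := by rw [← hba]; abel
    rw [hb', hu, smul_add, smul_smul, smul_smul, sub_smul]
    have : ‖v‖ / w * w * ‖v‖⁻¹ = 1 := by field_simp
    rw [this]
    module
  rw [hvb]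
  exact hconv ha hb (by rw [sub_nonneg, div_le_one hw0]; exact hv) (by positivity) (by ring)

/-- A body of constant width `w` contains every point at distance at most `w` from all its points:
a point outside lies beyond a supporting line, hence at distance more than `w` from the contact
point with the opposite supporting line. -/
theorem mem_of_forall_norm_sub_le (hKc : IsCompact K) (hKn : K.Nonempty) (hconv : Convex ℝ K)
    (hw : ∀ u : Plane, ‖u‖ = 1 → widthIn K u = w) {z : Plane} (hz : ∀ x ∈ K, ‖z - x‖ ≤ w) :
    z ∈ K := by
  by_contra hzK
  obtain ⟨f, s, hfs, hsz⟩ := geometric_hahn_banach_closed_point hconv hKc.isClosed hzK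
  set v := (InnerProductSpace.toDual ℝ Plane).symm f with hv
  have hfv : ∀ x, f x = ⟪v, x⟫ := fun x => by
    rw [hv, InnerProductSpace.toDual_symm_apply]
  have hv0 : v ≠ 0 := by
    intro h0
    obtain ⟨x, hx⟩ := hKn
    have h1 := hfs x hx
    rw [hfv, h0, inner_zero_left] at h1 hsz
    linarith
  have hn : 0 < ‖v‖ := norm_pos_iff.2 hv0
  set u := ‖v‖⁻¹ • v with hu
  have hu1 : ‖u‖ = 1 := norm_smul_inv_norm (𝕜 := ℝ) hv0
  have hfu : ∀ x, ⟪u, x⟫ = ‖v‖⁻¹ * f x := fun x => by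
    rw [hu, inner_smul_left, hfv]; simp
  obtain ⟨a, ha, b, hb, hab, hwid⟩ := exists_isMinOn_isMaxOn_inner hKc hKn u
  have h1 : ⟪u, b⟫ < ⟪u, z⟫ := by
    rw [hfu, hfu]
    have := hfs b hb
    gcongr
    linarith
  have h2 : ⟪u, z - a⟫ ≤ w := by
    calc ⟪u, z - a⟫ ≤ ‖u‖ * ‖z - a‖ := real_inner_le_norm _ _
      _ ≤ w := by rw [hu1, one_mul]; exact hz a ha
  rw [inner_sub_right] at h2
  linarith [hw u hu1]

/-- By Jung's theorem and `mem_of_forall_norm_sub_le`, a body of constant width `w` contains a disk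
of radius `(1 - 1 / √3) w`, which exceeds `0.4226 w`. -/
theorem exists_closedBall_subset (hKc : IsCompact K) (hKn : K.Nonempty) (hconv : Convex ℝ K)
    (hw : ∀ u : Plane, ‖u‖ = 1 → widthIn K u = w) :
    ∃ z, ∀ v : Plane, ‖v‖ ≤ w * 0.4226 → z + v ∈ K := by
  have hw0 := width_nonneg hKc hKn hw
  obtain ⟨z, hz⟩ := exists_center_of_dist_le (K := K) (d := w)
    fun x hx y hy => norm_sub_le_of_widthIn hKc hw hx hy hw0
  refine ⟨z, fun v hv => mem_of_forall_norm_sub_le hKc hKn hconv hw fun x hx => ?_⟩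
  have h3 : w / √3 ≤ w * 0.5774 := by
    rw [div_le_iff₀ (by positivity), mul_assoc]
    have : (1 : ℝ) ≤ 0.5774 * √3 := by
      have : (1.732 : ℝ) ≤ √3 := Real.le_sqrt_of_sq_le (by norm_num)
      linarith
    nlinarith
  calc ‖z + v - x‖ = ‖v - (x - z)‖ := by congr 1; abel
    _ ≤ ‖v‖ + ‖x - z‖ := norm_sub_le _ _
    _ ≤ w * 0.4226 + w * 0.5774 := add_le_add hv ((hz x hx).trans h3)
    _ = w := by ring

end ConstantWidth

/-! ### HexStar-shaped partitions of hexagons -/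

/-- The determinant of two vectors. -/
def cross (p q : ℝ × ℝ) : ℝ := p.1 * q.2 - p.2 * q.1

/-- A cyclic sequence of real numbers whose sign is not constant drops somewhere from nonnegative to
negative. -/
theorem exists_cyclic_sign_change {n : ℕ} [NeZero n] (s : Fin n → ℝ) :
    (∃ i, 0 ≤ s i ∧ s (i + 1) < 0) ∨ (∀ i, 0 ≤ s i) ∨ ∀ i, s i < 0 := by
  by_cases h : ∃ i, 0 ≤ s i ∧ s (i + 1) < 0
  · exact Or.inl h
  push Not at h
  by_cases h0 : ∀ i, s i < 0
  · exact Or.inr (Or.inr h0)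
  push Not at h0
  obtain ⟨j, hj⟩ := h0
  have hstep : ∀ k : ℕ, 0 ≤ s (j + Fin.ofNat n k) := by
    intro k
    induction k with
    | zero => simpa using hj
    | succ k ih =>
      have := h _ ih
      have e : j + Fin.ofNat n (k + 1) = j + Fin.ofNat n k + 1 := by
        rw [add_assoc]
        congr 1
        apply Fin.ext
        simp [Fin.val_add]
      rwa [e]
  refine Or.inr (Or.inl fun i => ?_)
  have := hstep (i - j : Fin n).val
  have e : j + Fin.ofNat n (i - j : Fin n).val = i := by simp
  rwa [e] at this

/-- The outer normals of a hexagon `|s₀| ≤ b₀, |s₁| ≤ b₁, |s₂| ≤ b₂`, where a point is given by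
the pair `(s₀, s₁)` and `s₂ = -s₀ - s₁`; they are listed in cyclic order. -/
def sideNormal : Fin 6 → ℝ × ℝ := ![(1, 0), (1, 1), (0, 1), (-1, 0), (-1, -1), (0, -1)]

/-- The linear functional attached to a side of the hexagon. -/
def side (k : Fin 6) (p : ℝ × ℝ) : ℝ := (sideNormal k).1 * p.1 + (sideNormal k).2 * p.2

/-- The half-width of the hexagon that bounds the functional `side k`. -/
def sideIndex : Fin 6 → Fin 3 := ![0, 2, 1, 0, 2, 1]

/-- A centre `o` and nine boundary points of the hexagon with half-widths `b`, in cyclic order: the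
six vertices and three cut points. The segments from `o` to the cut points divide the hexagon into
three pieces. -/
structure HexStar where
  /-- The half-widths of the hexagon. -/
  b : Fin 3 → ℝ
  /-- The centre. -/
  o : ℝ × ℝ
  /-- The boundary points. -/
  w : Fin 9 → ℝ × ℝ

/-- The combinatorics of a star: the side of the hexagon that carries each boundary edge, the
boundary points of the three pieces, and the three cut points. -/
structure HexPattern where
  /-- The side that carries the edge from a boundary point to the next. -/
  edge : Fin 9 → Fin 6
  /-- The boundary points of each piece. -/
  piece : Fin 3 → Finset (Fin 9)
  /-- The cut points. -/
  cut : Fin 3 → Fin 9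

/-- A star whose boundary edges lie on the sides prescribed by the pattern and whose centre is
strictly inside. -/
def HexStar.IsValid (S : HexStar) (P : HexPattern) : Prop :=
  ∀ i, side (P.edge i) (S.w i) = S.b (sideIndex (P.edge i)) ∧
    side (P.edge i) (S.w (i + 1)) = S.b (sideIndex (P.edge i)) ∧
    side (P.edge i) S.o < S.b (sideIndex (P.edge i))

/-- The weighted sum of three stars. -/
def HexStar.comb (α : Fin 3 → ℝ) (S : Fin 3 → HexStar) : HexStar where
  b k := ∑ m, α m * (S m).b k
  o := ∑ m, α m • (S m).o
  w i := ∑ m, α m • (S m).w i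

/-- The piece of a star spanned by the centre and the boundary points in `I` has a translate that
`Φ` maps into `K`. -/
def HexStar.Fits (K : Set Plane) (Φ : ℝ × ℝ →ₗ[ℝ] Plane) (S : HexStar)
    (I : Finset (Fin 9)) : Prop :=
  ∃ z, z + Φ S.o ∈ K ∧ ∀ i ∈ I, z + Φ (S.w i) ∈ K

/-- The symmetrised form of the determinants of the directions from the centres to the `i`-th and
`j`-th boundary points is positive on three stars. -/
def CrossPos (S : Fin 3 → HexStar) (i j : Fin 9) : Prop :=
  ∀ k l, k ≤ l → 0 < cross ((S k).w i - (S k).o) ((S l).w j - (S l).o) +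
    cross ((S l).w i - (S l).o) ((S k).w j - (S k).o)

theorem HexStar.comb_fits {K : Set Plane} (hK : Convex ℝ K) {Φ : ℝ × ℝ →ₗ[ℝ] Plane}
    {S : Fin 3 → HexStar} {α : Fin 3 → ℝ} (h0 : ∀ m, 0 ≤ α m) (h1 : ∑ m, α m = 1)
    {I : Finset (Fin 9)} (h : ∀ m, (S m).Fits K Φ I) : (HexStar.comb α S).Fits K Φ I := by
  choose z hzo hzw using h
  refine ⟨∑ m, α m • z m, ?_, fun i hi => ?_⟩
  · have := hK.sum_mem (t := Finset.univ) (fun m _ => h0 m) h1 (fun m _ => hzo m)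
    simpa [HexStar.comb, smul_add, Finset.sum_add_distrib] using this
  · have := hK.sum_mem (t := Finset.univ) (fun m _ => h0 m) h1 (fun m _ => hzw m i hi)
    simpa [HexStar.comb, smul_add, Finset.sum_add_distrib] using this

theorem HexStar.comb_isValid {P : HexPattern} {S : Fin 3 → HexStar} {α : Fin 3 → ℝ}
    (h0 : ∀ m, 0 ≤ α m) (h1 : ∑ m, α m = 1) (h : ∀ m, (S m).IsValid P) :
    (HexStar.comb α S).IsValid P := by
  have hside : ∀ k (v : Fin 3 → ℝ × ℝ), side k (∑ m, α m • v m) = ∑ m, α m * side k (v m) := by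
    intro k v
    simp only [side, Fin.sum_univ_three, Prod.fst_add, Prod.snd_add, Prod.smul_fst, Prod.smul_snd,
      smul_eq_mul]
    ring
  intro i
  refine ⟨?_, ?_, ?_⟩
  · simp only [HexStar.comb, hside, (h _ i).1]
  · simp only [HexStar.comb, hside, (h _ i).2.1]
  · simp only [HexStar.comb, hside]
    obtain ⟨m, hm⟩ : ∃ m, 0 < α m := by
      by_contra! hcon
      have : ∑ m, α m ≤ 0 := Finset.sum_nonpos fun m _ => hcon m
      linarith
    exact Finset.sum_lt_sum (fun m _ => mul_le_mul_of_nonneg_left (h m i).2.2.le (h0 m))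
      ⟨m, Finset.mem_univ m, mul_lt_mul_of_pos_left (h m i).2.2 hm⟩

theorem HexStar.comb_cross_pos {S : Fin 3 → HexStar} {α : Fin 3 → ℝ}
    (h0 : ∀ m, 0 ≤ α m) (h1 : ∑ m, α m = 1) {i j : Fin 9} (h : CrossPos S i j) :
    0 < cross ((HexStar.comb α S).w i - (HexStar.comb α S).o)
      ((HexStar.comb α S).w j - (HexStar.comb α S).o) := by
  set X : Fin 3 → Fin 3 → ℝ := fun k l => cross ((S k).w i - (S k).o) ((S l).w j - (S l).o) with hX
  have e : cross ((HexStar.comb α S).w i - (HexStar.comb α S).o)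
      ((HexStar.comb α S).w j - (HexStar.comb α S).o) =
      (α 0 * α 0 * (X 0 0 + X 0 0) + α 1 * α 1 * (X 1 1 + X 1 1) +
        α 2 * α 2 * (X 2 2 + X 2 2)) / 2 +
      (α 0 * α 1 * (X 0 1 + X 1 0) + α 0 * α 2 * (X 0 2 + X 2 0) +
        α 1 * α 2 * (X 1 2 + X 2 1)) := by
    simp only [hX, cross, HexStar.comb, Fin.sum_univ_three, Prod.fst_add, Prod.snd_add,
      Prod.smul_fst, Prod.smul_snd, Prod.fst_sub, Prod.snd_sub, smul_eq_mul]
    ring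
  rw [e]
  have a0 := h0 0
  have a1 := h0 1
  have a2 := h0 2
  have x01 : 0 < X 0 1 + X 1 0 := h 0 1 (by decide)
  have x02 : 0 < X 0 2 + X 2 0 := h 0 2 (by decide)
  have x12 : 0 < X 1 2 + X 2 1 := h 1 2 (by decide)
  have x00 : 0 < X 0 0 + X 0 0 := h 0 0 le_rfl
  have x11 : 0 < X 1 1 + X 1 1 := h 1 1 le_rfl
  have x22 : 0 < X 2 2 + X 2 2 := h 2 2 le_rfl
  rw [Fin.sum_univ_three] at h1
  have hpos : 0 < α 0 ∨ 0 < α 1 ∨ 0 < α 2 := by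
    by_contra! hcon
    linarith [hcon.1, hcon.2.1, hcon.2.2]
  rcases hpos with hp | hp | hp <;> positivity

/-- A point of the hexagon lies in one of the triangles spanned by the centre of a star and two
consecutive boundary points. The triangle is found where the sign of the determinant of `x - o`
with the directions to the boundary points changes from nonnegative to negative. -/
theorem HexStar.exists_mem_triangle {S : HexStar} {P : HexPattern} (hS : S.IsValid P)
    (hcross : ∀ i, 0 < cross (S.w i - S.o) (S.w (i + 1) - S.o))
    (hcut : ∀ m, 0 < cross (S.w (P.cut m) - S.o) (S.w (P.cut (m + 1)) - S.o))
    {x : ℝ × ℝ} (hx : ∀ k, side k x ≤ S.b (sideIndex k)) :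
    ∃ i, ∃ l r : ℝ, 0 ≤ l ∧ 0 ≤ r ∧ l + r ≤ 1 ∧
      x = (1 - l - r) • S.o + l • S.w i + r • S.w (i + 1) := by
  rcases exists_cyclic_sign_change fun i => cross (S.w i - S.o) (x - S.o) with
    ⟨i, hi, hi1⟩ | h
  · set p := S.w i - S.o with hp
    set q := S.w (i + 1) - S.o with hq
    have hD := hcross i
    rw [← hp, ← hq] at hD
    have hdec : x - S.o = (-cross q (x - S.o) / cross p q) • p +
        (cross p (x - S.o) / cross p q) • q := by
      apply Prod.ext
      · simp only [Prod.fst_add, Prod.smul_fst, smul_eq_mul]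
        field_simp
        simp only [cross]
        ring
      · simp only [Prod.snd_add, Prod.smul_snd, smul_eq_mul]
        field_simp
        simp only [cross]
        ring
    refine ⟨i, -cross q (x - S.o) / cross p q, cross p (x - S.o) / cross p q,
      div_nonneg (by linarith) hD.le, div_nonneg hi hD.le, ?_, ?_⟩
    · generalize -cross q (x - S.o) / cross p q = l at hdec
      generalize cross p (x - S.o) / cross p q = r at hdec
      obtain ⟨e1, e2, e3⟩ := hS i
      have e4 := hx (P.edge i)
      have hl1 : side (P.edge i) x - side (P.edge i) S.o =
          (l + r) * (S.b (sideIndex (P.edge i)) - side (P.edge i) S.o) := by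
        have f1 := congrArg Prod.fst hdec
        have f2 := congrArg Prod.snd hdec
        simp only [hp, hq, Prod.fst_add, Prod.snd_add, Prod.smul_fst, Prod.smul_snd, Prod.fst_sub,
          Prod.snd_sub, smul_eq_mul] at f1 f2
        simp only [side] at e1 e2 ⊢
        linear_combination (sideNormal (P.edge i)).1 * f1 + (sideNormal (P.edge i)).2 * f2 +
          l * e1 + r * e2
      by_contra! hcon
      nlinarith
    · generalize -cross q (x - S.o) / cross p q = l at hdec ⊢
      generalize cross p (x - S.o) / cross p q = r at hdec ⊢
      rw [eq_add_of_sub_eq' hdec, hp, hq]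
      module
  · -- The directions to the cut points positively span the plane, so the only point for which no
    -- sign change occurs is the centre itself.
    have hid : ∀ a b c y : ℝ × ℝ,
        cross b c * cross a y + cross c a * cross b y + cross a b * cross c y = 0 := by
      intro a b c y
      simp only [cross]
      ring
    have hsum := hid (S.w (P.cut 0) - S.o) (S.w (P.cut 1) - S.o) (S.w (P.cut 2) - S.o) (x - S.o)
    have c01 := hcut 0
    have c12 := hcut 1
    have c20 := hcut 2
    simp only [zero_add, show (1 : Fin 3) + 1 = 2 from rfl, show (2 : Fin 3) + 1 = 0 from rfl]
      at c01 c12 c20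
    rcases h with h | h
    · have s0 := h (P.cut 0)
      have s1 := h (P.cut 1)
      have s2 := h (P.cut 2)
      have t0 := mul_nonneg c12.le s0
      have t1 := mul_nonneg c20.le s1
      have t2 := mul_nonneg c01.le s2
      have z0 : cross (S.w (P.cut 0) - S.o) (x - S.o) = 0 :=
        (mul_eq_zero.1 (show _ = (0 : ℝ) by linarith)).resolve_left c12.ne'
      have z1 : cross (S.w (P.cut 1) - S.o) (x - S.o) = 0 :=
        (mul_eq_zero.1 (show _ = (0 : ℝ) by linarith)).resolve_left c20.ne'
      have hxo : x = S.o := by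
        generalize S.w (P.cut 0) - S.o = p at *
        generalize S.w (P.cut 1) - S.o = q at *
        have f1 : cross p q * (x - S.o).1 = 0 := by
          simp only [cross] at z0 z1 ⊢
          linear_combination q.1 * z0 - p.1 * z1
        have f2 : cross p q * (x - S.o).2 = 0 := by
          simp only [cross] at z0 z1 ⊢
          linear_combination q.2 * z0 - p.2 * z1
        have g1 := (mul_eq_zero.1 f1).resolve_left c01.ne'
        have g2 := (mul_eq_zero.1 f2).resolve_left c01.ne'
        exact Prod.ext (sub_eq_zero.1 g1) (sub_eq_zero.1 g2)
      exact ⟨0, 0, 0, le_rfl, le_rfl, by norm_num, by simp [hxo]⟩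
    · have t0 := mul_neg_of_pos_of_neg c12 (h (P.cut 0))
      have t1 := mul_neg_of_pos_of_neg c20 (h (P.cut 1))
      have t2 := mul_neg_of_pos_of_neg c01 (h (P.cut 2))
      linarith

/-- If the pieces of three stars fit into `K`, then the hexagons whose half-widths are convex
combinations of those of the stars are covered by three translates of the preimage of `K`. -/
theorem exists_cover_of_stars {K : Set Plane} (hK : Convex ℝ K) {Φ : ℝ × ℝ →ₗ[ℝ] Plane}
    {P : HexPattern} {S : Fin 3 → HexStar} (hP : ∀ i, ∃ m, i ∈ P.piece m ∧ i + 1 ∈ P.piece m)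
    (hS : ∀ m, (S m).IsValid P) (hcross : ∀ i, CrossPos S i (i + 1))
    (hcut : ∀ m, CrossPos S (P.cut m) (P.cut (m + 1)))
    (hfit : ∀ m n, (S m).Fits K Φ (P.piece n))
    {α : Fin 3 → ℝ} (h0 : ∀ m, 0 ≤ α m) (h1 : ∑ m, α m = 1) :
    ∃ z : Fin 3 → Plane, ∀ x : ℝ × ℝ,
      (∀ k, side k x ≤ ∑ m, α m * (S m).b (sideIndex k)) → ∃ n, z n + Φ x ∈ K := by
  have hfit' := fun n => HexStar.comb_fits hK h0 h1 (fun m => hfit m n)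
  choose z hzo hzw using hfit'
  refine ⟨z, fun x hx => ?_⟩
  obtain ⟨i, l, r, hl, hr, hlr, hxe⟩ := HexStar.exists_mem_triangle (HexStar.comb_isValid h0 h1 hS)
    (fun i => HexStar.comb_cross_pos h0 h1 (hcross i))
    (fun m => HexStar.comb_cross_pos h0 h1 (hcut m)) hx
  obtain ⟨n, hn, hn1⟩ := hP i
  refine ⟨n, ?_⟩
  set T := HexStar.comb α S
  have hmem := hK.sum_mem (t := Finset.univ) (w := ![1 - l - r, l, r])
    (z := ![z n + Φ T.o, z n + Φ (T.w i), z n + Φ (T.w (i + 1))])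
    (by intro m _; fin_cases m <;> simp <;> linarith)
    (by simp only [Fin.sum_univ_three, Matrix.cons_val]; ring)
    (by intro m _; fin_cases m <;> simp [hzo, hzw, hn, hn1, T])
  have e : z n + Φ x = ∑ m, (![1 - l - r, l, r] : Fin 3 → ℝ) m •
      (![z n + Φ T.o, z n + Φ (T.w i), z n + Φ (T.w (i + 1))] : Fin 3 → Plane) m := by
    rw [hxe]
    simp only [Fin.sum_univ_three, Matrix.cons_val_zero, Matrix.cons_val_one, Matrix.cons_val,
      map_add, map_smul]
    module
  rw [e]
  exact hmem

/-! ### Seven stars with small pieces -/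

/-- The squared Euclidean norm of the point with inner products `p.1`, `p.2`, `-p.1 - p.2` with
three unit vectors of sum zero. -/
noncomputable def sqNorm (p : ℝ × ℝ) : ℝ := 4 / 3 * (p.1 ^ 2 + p.1 * p.2 + p.2 ^ 2)

/-- The point `p` lies in the disk of radius `1 / √5` about `c`. -/
def InDisk (c p : ℝ × ℝ) : Prop := sqNorm (p - c) ≤ 1 / 5

/-- The point `p` is at distance at most `0.4226 (1 - a)` from the point with parameter
`t ∈ [-1/2, 1/2]` of the segment with midpoint `c` and direction `f`. -/
def InStadium (c f : ℝ × ℝ) (a t : ℝ) (p : ℝ × ℝ) : Prop :=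
  -(1 / 2) ≤ t ∧ t ≤ 1 / 2 ∧ sqNorm (p - c - t • f) ≤ ((1 - a) * 0.4226) ^ 2

/-- A piece of a star is small if it lies in a disk of radius `1 / √5` and also in a stadium, the
Minkowski sum of a segment of length at most `a` and a disk of radius `0.4226 (1 - a)`. A body of
constant width `1` contains a translate of every such stadium. -/
def HexStar.IsSmall (S : HexStar) (I : Finset (Fin 9)) : Prop :=
  (∃ c, InDisk c S.o ∧ ∀ i ∈ I, InDisk c (S.w i)) ∧
  ∃ c f a, 0 < a ∧ a < 1 ∧ sqNorm f ≤ a ^ 2 ∧ (∃ t, InStadium c f a t S.o) ∧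
    ∃ t : Fin 9 → ℝ, ∀ i ∈ I, InStadium c f a (t i) (S.w i)

theorem forall_fin_three {p : Fin 3 → Prop} (h0 : p 0) (h1 : p 1) (h2 : p 2) : ∀ n, p n := by
  intro n
  fin_cases n <;> assumption

theorem forall_fin_nine {p : Fin 9 → Prop} (h0 : p 0) (h1 : p 1) (h2 : p 2) (h3 : p 3) (h4 : p 4)
    (h5 : p 5) (h6 : p 6) (h7 : p 7) (h8 : p 8) : ∀ n, p n := by
  intro n
  fin_cases n <;> assumption

/-- The cuts end on three alternate sides of the hexagon. -/
def alternatePattern : HexPattern where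
  edge := ![1, 2, 3, 3, 4, 5, 5, 0, 1]
  piece := ![{0, 1, 2, 3}, {3, 4, 5, 6}, {6, 7, 8, 0}]
  cut := ![0, 3, 6]

/-- The cuts end on the two sides orthogonal to the third direction and on the side
`s₁ = b₁` next to one of them. -/
def skewPattern : HexPattern where
  edge := ![1, 2, 2, 3, 4, 4, 5, 0, 1]
  piece := ![{0, 1, 2}, {2, 3, 4, 5}, {5, 6, 7, 8, 0}]
  cut := ![0, 2, 5]

theorem crossPos_vec3 {S₀ S₁ S₂ : HexStar} {i j : Fin 9}
    (h00 : 0 < cross (S₀.w i - S₀.o) (S₀.w j - S₀.o))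
    (h11 : 0 < cross (S₁.w i - S₁.o) (S₁.w j - S₁.o))
    (h22 : 0 < cross (S₂.w i - S₂.o) (S₂.w j - S₂.o))
    (h01 : 0 < cross (S₀.w i - S₀.o) (S₁.w j - S₁.o) + cross (S₁.w i - S₁.o) (S₀.w j - S₀.o))
    (h02 : 0 < cross (S₀.w i - S₀.o) (S₂.w j - S₂.o) + cross (S₂.w i - S₂.o) (S₀.w j - S₀.o))
    (h12 : 0 < cross (S₁.w i - S₁.o) (S₂.w j - S₂.o) + cross (S₂.w i - S₂.o) (S₁.w j - S₁.o)) :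
    CrossPos ![S₀, S₁, S₂] i j := by
  intro k l hkl
  fin_cases k <;> fin_cases l
  · exact add_pos h00 h00
  · exact h01
  · exact h02
  · exact absurd hkl (by decide)
  · exact add_pos h11 h11
  · exact h12
  · exact absurd hkl (by decide)
  · exact absurd hkl (by decide)
  · exact add_pos h22 h22

/-- The regular hexagon, cut along the alternate pattern. -/
noncomputable def starA : HexStar where
  b := ![0.5, 0.5, 0.5]
  o := (-0.009, 0.021)
  w := ![
    (0.254, 0.246), (0, 0.5), (-0.5, 0.5), (-0.5, 0.254), (-0.5, 0), (0, -0.5), (0.246, -0.5),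
    (0.5, -0.5), (0.5, 0)]

theorem starA_isValid : starA.IsValid alternatePattern := by
  apply forall_fin_nine <;>
    simp only [starA, alternatePattern, side, sideNormal, sideIndex, Matrix.cons_val,
      Fin.reduceAdd] <;>
    norm_num

theorem starA_isSmall : ∀ n, starA.IsSmall (alternatePattern.piece n) := by
  apply forall_fin_three
  · refine ⟨⟨(-0.123, 0.25), ?_, ?_⟩, (-0.134, 0.272), (-0.318, 0.002), 0.367, by norm_num,
      by norm_num, ?_, ⟨0, ?_⟩, ![-0.5, -0.5, 0.5, 0.5, 0, 0, 0, 0, 0], ?_⟩ <;>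
    simp only [starA, alternatePattern, InDisk, InStadium, sqNorm, Matrix.cons_val,
      Finset.mem_insert, Finset.mem_singleton, forall_eq_or_imp, forall_eq, Prod.fst_sub,
      Prod.snd_sub, Prod.smul_fst, Prod.smul_snd, smul_eq_mul] <;>
    norm_num
  · refine ⟨⟨(-0.127, -0.123), ?_, ?_⟩, (-0.132, -0.128), (-0.278, 0.28), 0.323, by norm_num,
      by norm_num, ?_, ⟨0.05, ?_⟩, ![0, 0, 0, 0.5, 0.5, -0.5, -0.5, 0, 0], ?_⟩ <;>
    simp only [starA, alternatePattern, InDisk, InStadium, sqNorm, Matrix.cons_val,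
      Finset.mem_insert, Finset.mem_singleton, forall_eq_or_imp, forall_eq, Prod.fst_sub,
      Prod.snd_sub, Prod.smul_fst, Prod.smul_snd, smul_eq_mul] <;>
    norm_num
  · refine ⟨⟨(0.25, -0.127), ?_, ?_⟩, (0.261, -0.132), (0.002, 0.281), 0.326, by norm_num,
      by norm_num, ?_, ⟨0.06, ?_⟩, ![0.5, 0, 0, 0, 0, 0, -0.5, -0.5, 0.5], ?_⟩ <;>
    simp only [starA, alternatePattern, InDisk, InStadium, sqNorm, Matrix.cons_val,
      Finset.mem_insert, Finset.mem_singleton, forall_eq_or_imp, forall_eq, Prod.fst_sub,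
      Prod.snd_sub, Prod.smul_fst, Prod.smul_snd, smul_eq_mul] <;>
    norm_num

/-- A hexagon with two equal short half-widths, cut along the alternate pattern. Its pieces
barely satisfy the size bounds. -/
noncomputable def starM : HexStar where
  b := ![0.65, 0.425, 0.425]
  o := (-0.156, 0.154)
  w := ![
    (0.148, 0.277), (0, 0.425), (-0.65, 0.425), (-0.65, 0.331), (-0.65, 0.225), (0, -0.425),
    (0.137, -0.425), (0.65, -0.425), (0.65, -0.225)]

theorem starM_isValid : starM.IsValid alternatePattern := by
  apply forall_fin_nine <;>
    simp only [starM, alternatePattern, side, sideNormal, sideIndex, Matrix.cons_val,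
      Fin.reduceAdd] <;>
    norm_num

theorem starM_isSmall : ∀ n, starM.IsSmall (alternatePattern.piece n) := by
  apply forall_fin_three
  · refine ⟨⟨(-0.251, 0.304), ?_, ?_⟩, (-0.25, 0.301), (-0.529, 0.019), 0.601, by norm_num,
      by norm_num, ?_, ⟨-0.05, ?_⟩, ![-0.5, -0.5, 0.5, 0.5, 0, 0, 0, 0, 0], ?_⟩ <;>
    simp only [starM, alternatePattern, InDisk, InStadium, sqNorm, Matrix.cons_val,
      Finset.mem_insert, Finset.mem_singleton, forall_eq_or_imp, forall_eq, Prod.fst_sub,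
      Prod.snd_sub, Prod.smul_fst, Prod.smul_snd, smul_eq_mul] <;>
    norm_num
  · refine ⟨⟨(-0.256, -0.047), ?_, ?_⟩, (-0.239, -0.025), (0.322, -0.323), 0.373, by norm_num,
      by norm_num, ?_, ⟨-0.15, ?_⟩, ![0, 0, 0, -0.5, -0.5, 0.5, 0.5, 0, 0], ?_⟩ <;>
    simp only [starM, alternatePattern, InDisk, InStadium, sqNorm, Matrix.cons_val,
      Finset.mem_insert, Finset.mem_singleton, forall_eq_or_imp, forall_eq, Prod.fst_sub,
      Prod.snd_sub, Prod.smul_fst, Prod.smul_snd, smul_eq_mul] <;>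
    norm_num
  · refine ⟨⟨(0.246, -0.127), ?_, ?_⟩, (0.249, -0.128), (0.001, 0.01), 0.013, by norm_num,
      by norm_num, ?_, ⟨0.5, ?_⟩, ![0.5, 0, 0, 0, 0, 0, -0.5, -0.5, 0.5], ?_⟩ <;>
    simp only [starM, alternatePattern, InDisk, InStadium, sqNorm, Matrix.cons_val,
      Finset.mem_insert, Finset.mem_singleton, forall_eq_or_imp, forall_eq, Prod.fst_sub,
      Prod.snd_sub, Prod.smul_fst, Prod.smul_snd, smul_eq_mul] <;>
    norm_num

/-- A hexagon with two equal long half-widths, cut along the alternate pattern. -/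
noncomputable def starN : HexStar where
  b := ![0.55, 0.55, 0.4]
  o := (-0.073, -0.049)
  w := ![
    (0.179, 0.221), (-0.15, 0.55), (-0.55, 0.55), (-0.55, 0.189), (-0.55, 0.15), (0.15, -0.55),
    (0.235, -0.55), (0.55, -0.55), (0.55, -0.15)]

theorem starN_isValid : starN.IsValid alternatePattern := by
  apply forall_fin_nine <;>
    simp only [starN, alternatePattern, side, sideNormal, sideIndex, Matrix.cons_val,
      Fin.reduceAdd] <;>
    norm_num

theorem starN_isSmall : ∀ n, starN.IsSmall (alternatePattern.piece n) := by
  apply forall_fin_three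
  · refine ⟨⟨(-0.185, 0.205), ?_, ?_⟩, (-0.215, 0.26), (0.216, 0.007), 0.255, by norm_num,
      by norm_num, ?_, ⟨-0.09, ?_⟩, ![0.5, 0.5, -0.5, -0.5, 0, 0, 0, 0, 0], ?_⟩ <;>
    simp only [starN, alternatePattern, InDisk, InStadium, sqNorm, Matrix.cons_val,
      Finset.mem_insert, Finset.mem_singleton, forall_eq_or_imp, forall_eq, Prod.fst_sub,
      Prod.snd_sub, Prod.smul_fst, Prod.smul_snd, smul_eq_mul] <;>
    norm_num
  · refine ⟨⟨(-0.158, -0.181), ?_, ?_⟩, (-0.145, -0.166), (-0.45, 0.422), 0.505, by norm_num,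
      by norm_num, ?_, ⟨0.03, ?_⟩, ![0, 0, 0, 0.5, 0.5, -0.5, -0.5, 0, 0], ?_⟩ <;>
    simp only [starN, alternatePattern, InDisk, InStadium, sqNorm, Matrix.cons_val,
      Finset.mem_insert, Finset.mem_singleton, forall_eq_or_imp, forall_eq, Prod.fst_sub,
      Prod.snd_sub, Prod.smul_fst, Prod.smul_snd, smul_eq_mul] <;>
    norm_num
  · refine ⟨⟨(0.207, -0.165), ?_, ?_⟩, (0.25, -0.184), (-0.015, 0.193), 0.215, by norm_num,
      by norm_num, ?_, ⟨-0.04, ?_⟩, ![0.5, 0, 0, 0, 0, 0, -0.5, -0.5, 0.5], ?_⟩ <;>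
    simp only [starN, alternatePattern, InDisk, InStadium, sqNorm, Matrix.cons_val,
      Finset.mem_insert, Finset.mem_singleton, forall_eq_or_imp, forall_eq, Prod.fst_sub,
      Prod.snd_sub, Prod.smul_fst, Prod.smul_snd, smul_eq_mul] <;>
    norm_num

/-- The hexagon of `starM`, cut along the skew pattern. -/
noncomputable def skewStarM : HexStar where
  b := ![0.65, 0.425, 0.425]
  o := (-0.029, -0.076)
  w := ![
    (0.452, -0.027), (0, 0.425), (-0.425, 0.425), (-0.65, 0.425), (-0.65, 0.225),
    (-0.003, -0.422), (0, -0.425), (0.65, -0.425), (0.65, -0.225)]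

theorem skewStarM_isValid : skewStarM.IsValid skewPattern := by
  apply forall_fin_nine <;>
    simp only [skewStarM, skewPattern, side, sideNormal, sideIndex, Matrix.cons_val,
      Fin.reduceAdd] <;>
    norm_num

theorem skewStarM_isSmall : ∀ n, skewStarM.IsSmall (skewPattern.piece n) := by
  apply forall_fin_three
  · refine ⟨⟨(0.013, 0.199), ?_, ?_⟩, (0.012, 0.165), (0.281, -0.136), 0.282, by norm_num,
      by norm_num, ?_, ⟨-0.17, ?_⟩, ![0.5, -0.02, -0.5, 0, 0, 0, 0, 0, 0], ?_⟩ <;>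
    simp only [skewStarM, skewPattern, InDisk, InStadium, sqNorm, Matrix.cons_val,
      Finset.mem_insert, Finset.mem_singleton, forall_eq_or_imp, forall_eq, Prod.fst_sub,
      Prod.snd_sub, Prod.smul_fst, Prod.smul_snd, smul_eq_mul] <;>
    norm_num
  · refine ⟨⟨(-0.326, 0.002), ?_, ?_⟩, (-0.304, 0.016), (-0.258, 0.399), 0.405, by norm_num,
      by norm_num, ?_, ⟨-0.33, ?_⟩, ![0, 0, 0.5, 0.5, 0.5, -0.5, 0, 0, 0], ?_⟩ <;>
    simp only [skewStarM, skewPattern, InDisk, InStadium, sqNorm, Matrix.cons_val,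
      Finset.mem_insert, Finset.mem_singleton, forall_eq_or_imp, forall_eq, Prod.fst_sub,
      Prod.snd_sub, Prod.smul_fst, Prod.smul_snd, smul_eq_mul] <;>
    norm_num
  · refine ⟨⟨(0.323, -0.323), ?_, ?_⟩, (0.289, -0.276), (0.306, 0.081), 0.409, by norm_num,
      by norm_num, ?_, ⟨-0.5, ?_⟩, ![0.5, 0, 0, 0, 0, -0.5, -0.5, 0.5, 0.5], ?_⟩ <;>
    simp only [skewStarM, skewPattern, InDisk, InStadium, sqNorm, Matrix.cons_val,
      Finset.mem_insert, Finset.mem_singleton, forall_eq_or_imp, forall_eq, Prod.fst_sub,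
      Prod.snd_sub, Prod.smul_fst, Prod.smul_snd, smul_eq_mul] <;>
    norm_num

/-- The hexagon of `starN`, cut along the skew pattern. -/
noncomputable def skewStarN : HexStar where
  b := ![0.55, 0.55, 0.4]
  o := (0.025, -0.039)
  w := ![
    (0.414, -0.014), (-0.15, 0.55), (-0.432, 0.55), (-0.55, 0.55), (-0.55, 0.15),
    (-0.095, -0.305), (0.15, -0.55), (0.55, -0.55), (0.55, -0.15)]

theorem skewStarN_isValid : skewStarN.IsValid skewPattern := by
  apply forall_fin_nine <;>
    simp only [skewStarN, skewPattern, side, sideNormal, sideIndex, Matrix.cons_val,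
      Fin.reduceAdd] <;>
    norm_num

theorem skewStarN_isSmall : ∀ n, skewStarN.IsSmall (skewPattern.piece n) := by
  apply forall_fin_three
  · refine ⟨⟨(-0.009, 0.268), ?_, ?_⟩, (-0.015, 0.234), (-0.315, 0.231), 0.327, by norm_num,
      by norm_num, ?_, ⟨-0.35, ?_⟩, ![-0.5, 0.5, 0.5, 0, 0, 0, 0, 0, 0], ?_⟩ <;>
    simp only [skewStarN, skewPattern, InDisk, InStadium, sqNorm, Matrix.cons_val,
      Finset.mem_insert, Finset.mem_singleton, forall_eq_or_imp, forall_eq, Prod.fst_sub,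
      Prod.snd_sub, Prod.smul_fst, Prod.smul_snd, smul_eq_mul] <;>
    norm_num
  · refine ⟨⟨(-0.278, 0.124), ?_, ?_⟩, (-0.292, 0.126), (0.121, -0.293), 0.295, by norm_num,
      by norm_num, ?_, ⟨0.47, ?_⟩, ![0, 0, -0.5, -0.5, 0.02, 0.5, 0, 0, 0], ?_⟩ <;>
    simp only [skewStarN, skewPattern, InDisk, InStadium, sqNorm, Matrix.cons_val,
      Finset.mem_insert, Finset.mem_singleton, forall_eq_or_imp, forall_eq, Prod.fst_sub,
      Prod.snd_sub, Prod.smul_fst, Prod.smul_snd, smul_eq_mul] <;>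
    norm_num
  · refine ⟨⟨(0.228, -0.228), ?_, ?_⟩, (0.249, -0.261), (0.154, 0.045), 0.209, by norm_num,
      by norm_num, ?_, ⟨-0.38, ?_⟩, ![0.5, 0, 0, 0, 0, -0.5, -0.5, 0.5, 0.5], ?_⟩ <;>
    simp only [skewStarN, skewPattern, InDisk, InStadium, sqNorm, Matrix.cons_val,
      Finset.mem_insert, Finset.mem_singleton, forall_eq_or_imp, forall_eq, Prod.fst_sub,
      Prod.snd_sub, Prod.smul_fst, Prod.smul_snd, smul_eq_mul] <;>
    norm_num

/-- A hexagon slightly larger than the rhombus with half-widths `0.75, 0.375, 0.375`. The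
enlargement keeps its vertices distinct. -/
noncomputable def skewStarB : HexStar where
  b := ![0.75, 0.38, 0.38]
  o := (0.023, -0.101)
  w := ![
    (0.44, -0.06), (0, 0.38), (-0.435, 0.38), (-0.75, 0.38), (-0.75, 0.37), (-0.004, -0.376),
    (0, -0.38), (0.75, -0.38), (0.75, -0.37)]

theorem skewStarB_isValid : skewStarB.IsValid skewPattern := by
  apply forall_fin_nine <;>
    simp only [skewStarB, skewPattern, side, sideNormal, sideIndex, Matrix.cons_val,
      Fin.reduceAdd] <;>
    norm_num

theorem skewStarB_isSmall : ∀ n, skewStarB.IsSmall (skewPattern.piece n) := by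
  apply forall_fin_three
  · refine ⟨⟨(0.003, 0.16), ?_, ?_⟩, (0.003, 0.144), (-0.334, 0.172), 0.335, by norm_num,
      by norm_num, ?_, ⟨-0.07, ?_⟩, ![-0.5, 0.02, 0.5, 0, 0, 0, 0, 0, 0], ?_⟩ <;>
    simp only [skewStarB, skewPattern, InDisk, InStadium, sqNorm, Matrix.cons_val,
      Finset.mem_insert, Finset.mem_singleton, forall_eq_or_imp, forall_eq, Prod.fst_sub,
      Prod.snd_sub, Prod.smul_fst, Prod.smul_snd, smul_eq_mul] <;>
    norm_num
  · refine ⟨⟨(-0.377, 0.002), ?_, ?_⟩, (-0.347, 0.031), (-0.293, 0.301), 0.344, by norm_num,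
      by norm_num, ?_, ⟨-0.5, ?_⟩, ![0, 0, 0.5, 0.5, 0.5, -0.5, 0, 0, 0], ?_⟩ <;>
    simp only [skewStarB, skewPattern, InDisk, InStadium, sqNorm, Matrix.cons_val,
      Finset.mem_insert, Finset.mem_singleton, forall_eq_or_imp, forall_eq, Prod.fst_sub,
      Prod.snd_sub, Prod.smul_fst, Prod.smul_snd, smul_eq_mul] <;>
    norm_num
  · refine ⟨⟨(0.373, -0.373), ?_, ?_⟩, (0.351, -0.323), (0.312, 0.039), 0.386, by norm_num,
      by norm_num, ?_, ⟨-0.5, ?_⟩, ![0.5, 0, 0, 0, 0, -0.5, -0.5, 0.5, 0.5], ?_⟩ <;>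
    simp only [skewStarB, skewPattern, InDisk, InStadium, sqNorm, Matrix.cons_val,
      Finset.mem_insert, Finset.mem_singleton, forall_eq_or_imp, forall_eq, Prod.fst_sub,
      Prod.snd_sub, Prod.smul_fst, Prod.smul_snd, smul_eq_mul] <;>
    norm_num

/-- A thin hexagon around the segment with half-widths `0.75, 0.75, 0`. -/
noncomputable def skewStarC : HexStar where
  b := ![0.75, 0.75, 0.06]
  o := (-0.002, -0.002)
  w := ![
    (0.049, 0.011), (-0.69, 0.75), (-0.696, 0.75), (-0.75, 0.75), (-0.75, 0.69), (-0.03, -0.03),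
    (0.69, -0.75), (0.75, -0.75), (0.75, -0.69)]

theorem skewStarC_isValid : skewStarC.IsValid skewPattern := by
  apply forall_fin_nine <;>
    simp only [skewStarC, skewPattern, side, sideNormal, sideIndex, Matrix.cons_val,
      Fin.reduceAdd] <;>
    norm_num

theorem skewStarC_isSmall : ∀ n, skewStarC.IsSmall (skewPattern.piece n) := by
  apply forall_fin_three
  · refine ⟨⟨(-0.324, 0.381), ?_, ?_⟩, (-0.327, 0.373), (0.656, -0.67), 0.766, by norm_num,
      by norm_num, ?_, ⟨0.5, ?_⟩, ![0.5, -0.5, -0.5, 0, 0, 0, 0, 0, 0], ?_⟩ <;>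
    simp only [skewStarC, skewPattern, InDisk, InStadium, sqNorm, Matrix.cons_val,
      Finset.mem_insert, Finset.mem_singleton, forall_eq_or_imp, forall_eq, Prod.fst_sub,
      Prod.snd_sub, Prod.smul_fst, Prod.smul_snd, smul_eq_mul] <;>
    norm_num
  · refine ⟨⟨(-0.39, 0.36), ?_, ?_⟩, (-0.381, 0.364), (-0.626, 0.656), 0.741, by norm_num,
      by norm_num, ?_, ⟨-0.5, ?_⟩, ![0, 0, 0.5, 0.5, 0.5, -0.5, 0, 0, 0], ?_⟩ <;>
    simp only [skewStarC, skewPattern, InDisk, InStadium, sqNorm, Matrix.cons_val,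
      Finset.mem_insert, Finset.mem_singleton, forall_eq_or_imp, forall_eq, Prod.fst_sub,
      Prod.snd_sub, Prod.smul_fst, Prod.smul_snd, smul_eq_mul] <;>
    norm_num
  · refine ⟨⟨(0.36, -0.389), ?_, ?_⟩, (0.366, -0.372), (-0.611, 0.598), 0.699, by norm_num,
      by norm_num, ?_, ⟨0.5, ?_⟩, ![0.5, 0, 0, 0, 0, 0.5, -0.5, -0.5, -0.5], ?_⟩ <;>
    simp only [skewStarC, skewPattern, InDisk, InStadium, sqNorm, Matrix.cons_val,
      Finset.mem_insert, Finset.mem_singleton, forall_eq_or_imp, forall_eq, Prod.fst_sub,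
      Prod.snd_sub, Prod.smul_fst, Prod.smul_snd, smul_eq_mul] <;>
    norm_num

theorem starAMN_cross_pos :
    ∀ i, CrossPos ![starA, starM, starN] i (i + 1) := by
  apply forall_fin_nine <;> apply crossPos_vec3 <;>
    simp only [starA, starM, starN, cross, Matrix.cons_val,
      Fin.reduceAdd, Prod.fst_sub, Prod.snd_sub] <;>
    norm_num

theorem starAMN_cut_pos :
    ∀ m, CrossPos ![starA, starM, starN] (alternatePattern.cut m)
      (alternatePattern.cut (m + 1)) := by
  apply forall_fin_three <;> apply crossPos_vec3 <;>
    simp only [starA, starM, starN, alternatePattern, cross, Matrix.cons_val,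
      Fin.reduceAdd, Prod.fst_sub, Prod.snd_sub] <;>
    norm_num

theorem skewStarMNC_cross_pos :
    ∀ i, CrossPos ![skewStarM, skewStarN, skewStarC] i (i + 1) := by
  apply forall_fin_nine <;> apply crossPos_vec3 <;>
    simp only [skewStarM, skewStarN, skewStarC, cross, Matrix.cons_val,
      Fin.reduceAdd, Prod.fst_sub, Prod.snd_sub] <;>
    norm_num

theorem skewStarMNC_cut_pos :
    ∀ m, CrossPos ![skewStarM, skewStarN, skewStarC] (skewPattern.cut m)
      (skewPattern.cut (m + 1)) := by
  apply forall_fin_three <;> apply crossPos_vec3 <;>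
    simp only [skewStarM, skewStarN, skewStarC, skewPattern, cross, Matrix.cons_val,
      Fin.reduceAdd, Prod.fst_sub, Prod.snd_sub] <;>
    norm_num

theorem skewStarMBC_cross_pos :
    ∀ i, CrossPos ![skewStarM, skewStarB, skewStarC] i (i + 1) := by
  apply forall_fin_nine <;> apply crossPos_vec3 <;>
    simp only [skewStarM, skewStarB, skewStarC, cross, Matrix.cons_val,
      Fin.reduceAdd, Prod.fst_sub, Prod.snd_sub] <;>
    norm_num

theorem skewStarMBC_cut_pos :
    ∀ m, CrossPos ![skewStarM, skewStarB, skewStarC] (skewPattern.cut m)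
      (skewPattern.cut (m + 1)) := by
  apply forall_fin_three <;> apply crossPos_vec3 <;>
    simp only [skewStarM, skewStarB, skewStarC, skewPattern, cross, Matrix.cons_val,
      Fin.reduceAdd, Prod.fst_sub, Prod.snd_sub] <;>
    norm_num

/-! ### Covering hexagons -/

/-- If the half-widths `b` are dominated by a convex combination of the half-widths of three stars
with small pieces, then the hexagon with half-widths `b` is covered. -/
theorem exists_cover_of_le {K : Set Plane} (hK : Convex ℝ K) {Φ : ℝ × ℝ →ₗ[ℝ] Plane}
    (hfit : ∀ S I, HexStar.IsSmall S I → S.Fits K Φ I) {P : HexPattern} {S₀ S₁ S₂ : HexStar}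
    (hP : ∀ i, ∃ m, i ∈ P.piece m ∧ i + 1 ∈ P.piece m)
    (hv₀ : S₀.IsValid P) (hv₁ : S₁.IsValid P) (hv₂ : S₂.IsValid P)
    (hs₀ : ∀ n, S₀.IsSmall (P.piece n)) (hs₁ : ∀ n, S₁.IsSmall (P.piece n))
    (hs₂ : ∀ n, S₂.IsSmall (P.piece n)) (hcross : ∀ i, CrossPos ![S₀, S₁, S₂] i (i + 1))
    (hcut : ∀ m, CrossPos ![S₀, S₁, S₂] (P.cut m) (P.cut (m + 1)))
    {α₀ α₁ α₂ : ℝ} (h₀ : 0 ≤ α₀) (h₁ : 0 ≤ α₁) (h₂ : 0 ≤ α₂) (hα : α₀ + α₁ + α₂ = 1)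
    {b : Fin 3 → ℝ} (hb : ∀ k, b k ≤ α₀ * S₀.b k + α₁ * S₁.b k + α₂ * S₂.b k) :
    ∃ z : Fin 3 → Plane, ∀ x : ℝ × ℝ, |x.1| ≤ b 0 → |x.2| ≤ b 1 → |x.1 + x.2| ≤ b 2 →
      ∃ n, z n + Φ x ∈ K := by
  obtain ⟨z, hz⟩ := exists_cover_of_stars hK (Φ := Φ) hP (S := ![S₀, S₁, S₂])
    (forall_fin_three hv₀ hv₁ hv₂) hcross hcut
    (forall_fin_three (fun n => hfit _ _ (hs₀ n)) (fun n => hfit _ _ (hs₁ n))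
      (fun n => hfit _ _ (hs₂ n)))
    (α := ![α₀, α₁, α₂]) (forall_fin_three h₀ h₁ h₂) (by simpa [Fin.sum_univ_three] using hα)
  refine ⟨z, fun x h0 h1 h2 => hz x fun k => ?_⟩
  have hk := hb (sideIndex k)
  refine le_trans ?_ (hk.trans_eq (by simp [Fin.sum_univ_three]))
  rw [abs_le] at h0 h1 h2
  fin_cases k <;> simp [side, sideNormal, sideIndex] <;>
    linarith [h0.1, h0.2, h1.1, h1.2, h2.1, h2.2]

/-- A hexagon with half-widths in decreasing order and of sum at most `3 / 2` is covered by three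
translates of a set that contains translates of the small pieces. The parameter triangle
`b₂ ≤ b₁ ≤ b₀ ≤ b₁ + b₂` is divided into three smaller triangles; the value of `b₀` is
irrelevant as soon as it exceeds `b₁ + b₂`. -/
theorem exists_cover_of_antitone {K : Set Plane} (hK : Convex ℝ K) {Φ : ℝ × ℝ →ₗ[ℝ] Plane}
    (hfit : ∀ S I, HexStar.IsSmall S I → S.Fits K Φ I) {b : Fin 3 → ℝ} (h2 : 0 ≤ b 2)
    (h12 : b 2 ≤ b 1) (h01 : b 1 ≤ b 0) (hsum : b 0 + b 1 + b 2 ≤ 3 / 2) :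
    ∃ z : Fin 3 → Plane, ∀ x : ℝ × ℝ, |x.1| ≤ b 0 → |x.2| ≤ b 1 → |x.1 + x.2| ≤ b 2 →
      ∃ n, z n + Φ x ∈ K := by
  wlog htri : b 0 ≤ b 1 + b 2 generalizing b
  · obtain ⟨z, hz⟩ := this (b := ![b 1 + b 2, b 1, b 2]) (by simpa using h2) (by simpa using h12)
      (by simpa using h2) (by simp; linarith) (by simp)
    refine ⟨z, fun x h0 h1 h2 => hz x ?_ h1 h2⟩
    have e : x.1 = (x.1 + x.2) - x.2 := by ring
    have := abs_sub (x.1 + x.2) x.2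
    rw [← e] at this
    simp
    linarith
  have hPa : ∀ i, ∃ m, i ∈ alternatePattern.piece m ∧ i + 1 ∈ alternatePattern.piece m := by
    decide
  have hPs : ∀ i, ∃ m, i ∈ skewPattern.piece m ∧ i + 1 ∈ skewPattern.piece m := by
    decide
  -- The weights are the coordinates of `b` with respect to the three corners, with
  -- `(0.75, 0.375, 0.375)` and `(0.75, 0.75, 0)` in place of the half-widths of `skewStarB` and
  -- `skewStarC`; the weight missing to `1` is added to the first corner.
  rcases le_total 0 (-34 * b 0 - 14 * b 1 + 66 * b 2) with hA | hA
  · refine exists_cover_of_le hK hfit hPa starA_isValid starM_isValid starN_isValid starA_isSmall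
      starM_isSmall starN_isSmall starAMN_cross_pos starAMN_cut_pos
      (α₀ := (-34 * b 0 - 14 * b 1 + 66 * b 2) / 9 + (1 - 2 / 3 * (b 0 + b 1 + b 2)))
      (α₁ := 40 / 9 * (b 0 - b 1)) (α₂ := 20 / 3 * (b 1 - b 2))
      (by linarith) (by linarith) (by linarith) (by ring) (forall_fin_three ?_ ?_ ?_) <;>
    · simp only [starA, starM, starN, Matrix.cons_val]
      linarith
  · rcases le_total 0 (-85 * b 0 + 85 * b 1 + 45 * b 2) with hM | hM
    · refine exists_cover_of_le hK hfit hPs skewStarM_isValid skewStarN_isValid skewStarC_isValid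
        skewStarM_isSmall skewStarN_isSmall skewStarC_isSmall skewStarMNC_cross_pos
        skewStarMNC_cut_pos
        (α₀ := 40 / 9 * (b 0 - b 1) + (1 - 2 / 3 * (b 0 + b 1 + b 2)))
        (α₁ := (-85 * b 0 + 85 * b 1 + 45 * b 2) / 18)
        (α₂ := (17 * b 0 + 7 * b 1 - 33 * b 2) / 18)
        (by linarith) (by linarith) (by linarith) (by ring) (forall_fin_three ?_ ?_ ?_) <;>
      · simp only [skewStarM, skewStarN, skewStarC, Matrix.cons_val]
        linarith
    · refine exists_cover_of_le hK hfit hPs skewStarM_isValid skewStarB_isValid skewStarC_isValid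
        skewStarM_isSmall skewStarB_isSmall skewStarC_isSmall skewStarMBC_cross_pos
        skewStarMBC_cut_pos
        (α₀ := 5 * (b 1 + b 2 - b 0) + (1 - 2 / 3 * (b 0 + b 1 + b 2)))
        (α₁ := (17 * b 0 - 17 * b 1 - 9 * b 2) / 3)
        (α₂ := 4 / 3 * (b 1 - b 2))
        (by linarith) (by linarith) (by linarith) (by ring) (forall_fin_three ?_ ?_ ?_) <;>
      · simp only [skewStarM, skewStarB, skewStarC, Matrix.cons_val]
        linarith

/-! ### Frames of three unit vectors -/

/-- Three unit vectors of sum zero. -/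
structure IsFrame (u : Fin 3 → Plane) : Prop where
  norm_eq_one : ∀ i, ‖u i‖ = 1
  sum_eq_zero : u 0 + u 1 + u 2 = 0

theorem IsFrame.comp_perm {u : Fin 3 → Plane} (hu : IsFrame u) (σ : Equiv.Perm (Fin 3)) :
    IsFrame (u ∘ σ) where
  norm_eq_one i := hu.norm_eq_one _
  sum_eq_zero := by
    have h := Equiv.sum_comp σ u
    rw [Fin.sum_univ_three, Fin.sum_univ_three, hu.sum_eq_zero] at h
    exact h

theorem IsFrame.inner_eq {u : Fin 3 → Plane} (hu : IsFrame u) : ⟪u 0, u 1⟫ = -(1 / 2 : ℝ) := by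
  have h : u 0 + u 1 = -u 2 := eq_neg_of_add_eq_zero_left hu.sum_eq_zero
  have h2 : ‖u 0 + u 1‖ ^ 2 = 1 := by rw [h, norm_neg, hu.norm_eq_one]; norm_num
  rw [norm_add_sq_real, hu.norm_eq_one, hu.norm_eq_one] at h2
  linarith

/-- The point whose inner products with `u 0` and `u 1` are the two given numbers, for a
frame `u`. -/
noncomputable def coordMap (u : Fin 3 → Plane) : ℝ × ℝ →ₗ[ℝ] Plane where
  toFun p := (2 / 3 : ℝ) • ((2 * p.1 + p.2) • u 0 + (p.1 + 2 * p.2) • u 1)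
  map_add' p q := by
    simp only [Prod.fst_add, Prod.snd_add]
    module
  map_smul' c p := by
    simp only [Prod.smul_fst, Prod.smul_snd, smul_eq_mul, RingHom.id_apply]
    module

theorem coordMap_apply (u : Fin 3 → Plane) (p : ℝ × ℝ) :
    coordMap u p = (2 / 3 : ℝ) • ((2 * p.1 + p.2) • u 0 + (p.1 + 2 * p.2) • u 1) := rfl

theorem norm_sq_coordMap {u : Fin 3 → Plane} (hu : IsFrame u) (p : ℝ × ℝ) :
    ‖coordMap u p‖ ^ 2 = sqNorm p := by
  rw [coordMap_apply, norm_smul, mul_pow, norm_add_sq_real, norm_smul, norm_smul,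
    hu.norm_eq_one, hu.norm_eq_one, inner_smul_left, inner_smul_right, hu.inner_eq]
  simp only [mul_one, Real.norm_eq_abs, sq_abs, conj_trivial, sqNorm]
  ring

theorem coordMap_inner {u : Fin 3 → Plane} (hu : IsFrame u) (x : Plane) :
    coordMap u (⟪u 0, x⟫, ⟪u 1, x⟫) = x := by
  set y := coordMap u (⟪u 0, x⟫, ⟪u 1, x⟫) - x with hy
  have n0 : ⟪u 0, u 0⟫ = (1 : ℝ) := by rw [real_inner_self_eq_norm_sq, hu.norm_eq_one]; norm_num
  have n1 : ⟪u 1, u 1⟫ = (1 : ℝ) := by rw [real_inner_self_eq_norm_sq, hu.norm_eq_one]; norm_num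
  have n10 : ⟪u 1, u 0⟫ = -(1 / 2 : ℝ) := by rw [real_inner_comm]; exact hu.inner_eq
  have h0 : ⟪u 0, y⟫ = (0 : ℝ) := by
    rw [hy, coordMap_apply, inner_sub_right, inner_smul_right, inner_add_right, inner_smul_right,
      inner_smul_right, n0, hu.inner_eq]
    ring
  have h1 : ⟪u 1, y⟫ = (0 : ℝ) := by
    rw [hy, coordMap_apply, inner_sub_right, inner_smul_right, inner_add_right, inner_smul_right,
      inner_smul_right, n1, n10]
    ring
  have hn01 := hu.inner_eq
  simp only [PiLp.inner_apply, Fin.sum_univ_two, RCLike.inner_apply, conj_trivial]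
    at h0 h1 n0 n1 hn01
  -- The determinant of `u 0` and `u 1` has square `3 / 4`.
  have hdet : (u 0 0 * u 1 1 - u 0 1 * u 1 0) ^ 2 = 3 / 4 := by
    linear_combination (u 1 0 * u 1 0 + u 1 1 * u 1 1) * n0 + n1 -
      (u 1 0 * u 0 0 + u 1 1 * u 0 1 - 1 / 2) * hn01
  have hdet0 : u 0 0 * u 1 1 - u 0 1 * u 1 0 ≠ 0 := by
    intro h
    rw [h] at hdet
    norm_num at hdet
  have e0 : (u 0 0 * u 1 1 - u 0 1 * u 1 0) * y 0 = 0 := by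
    linear_combination u 1 1 * h0 - u 0 1 * h1
  have e1 : (u 0 0 * u 1 1 - u 0 1 * u 1 0) * y 1 = 0 := by
    linear_combination u 0 0 * h1 - u 1 0 * h0
  have hy0 : y = 0 := by
    ext i
    fin_cases i
    · exact (mul_eq_zero.1 e0).resolve_left hdet0
    · exact (mul_eq_zero.1 e1).resolve_left hdet0
  exact sub_eq_zero.1 hy0

/-! ### Small pieces fit -/

/-- A set that contains a disk of radius `R / √5` contains translates of all small pieces, scaled
by `R`. -/
theorem HexStar.IsSmall.fits_of_disk {K : Set Plane} {R : ℝ} {z₀ : Plane}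
    (hz₀ : ∀ v : Plane, ‖v‖ ^ 2 ≤ R ^ 2 / 5 → z₀ + v ∈ K) {u : Fin 3 → Plane} (hu : IsFrame u)
    {S : HexStar} {I : Finset (Fin 9)} (hS : S.IsSmall I) : S.Fits K (R • coordMap u) I := by
  obtain ⟨⟨c, ho, hw⟩, -⟩ := hS
  have key : ∀ p, InDisk c p → z₀ - (R • coordMap u) c + (R • coordMap u) p ∈ K := by
    intro p hp
    have e : z₀ - (R • coordMap u) c + (R • coordMap u) p = z₀ + R • coordMap u (p - c) := by
      rw [map_sub, LinearMap.smul_apply, LinearMap.smul_apply]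
      module
    rw [e]
    apply hz₀
    rw [norm_smul, mul_pow, norm_sq_coordMap hu, Real.norm_eq_abs, sq_abs]
    have := mul_le_mul_of_nonneg_left hp (sq_nonneg R)
    linarith
  exact ⟨_, key _ ho, fun i hi => key _ (hw i hi)⟩

/-- A body of constant width `w` contains `a` times a chord of length at most `w` plus `1 - a`
times a disk of radius `0.4226 w`. -/
theorem HexStar.IsSmall.fits_of_constantWidth {K : Set Plane} {w : ℝ} (hKc : IsCompact K)
    (hKn : K.Nonempty) (hconv : Convex ℝ K) (hw : ∀ u : Plane, ‖u‖ = 1 → widthIn K u = w)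
    {u : Fin 3 → Plane} (hu : IsFrame u)
    {S : HexStar} {I : Finset (Fin 9)} (hS : S.IsSmall I) : S.Fits K (w • coordMap u) I := by
  obtain ⟨-, c, f, a, ha0, ha1, hf, ⟨t₀, ho⟩, t, ht⟩ := hS
  have hw0 := width_nonneg hKc hKn hw
  obtain ⟨z₀, hz₀⟩ := exists_closedBall_subset hKc hKn hconv hw
  set Φ := w • coordMap u with hΦ
  have hnorm : ∀ p, ‖Φ p‖ ^ 2 = w ^ 2 * sqNorm p := by
    intro p
    rw [hΦ, LinearMap.smul_apply, norm_smul, mul_pow, norm_sq_coordMap hu, Real.norm_eq_abs,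
      sq_abs]
  obtain ⟨y, hy, hyd⟩ := exists_chord hKc hKn hconv hw (v := a⁻¹ • Φ f) (by
    rw [norm_smul, norm_inv, Real.norm_of_nonneg ha0.le, inv_mul_le_iff₀ ha0]
    refine le_of_sq_le_sq ?_ (by positivity)
    rw [hnorm, mul_pow, mul_comm]
    gcongr)
  have key : ∀ s p, InStadium c f a s p →
      (a • (y + (1 / 2 : ℝ) • a⁻¹ • Φ f) + (1 - a) • z₀ - Φ c) + Φ p ∈ K := by
    intro s p ⟨hs0, hs1, hp⟩
    have h1a : 0 < 1 - a := by linarith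
    have m1 : y + (1 / 2 + s) • a⁻¹ • Φ f ∈ K := by
      have e : y + (1 / 2 + s) • a⁻¹ • Φ f =
          (1 / 2 - s) • y + (1 / 2 + s) • (y + a⁻¹ • Φ f) := by module
      rw [e]
      exact hconv hy hyd (by linarith) (by linarith) (by ring)
    have m2 : z₀ + (1 - a)⁻¹ • Φ (p - c - s • f) ∈ K := by
      apply hz₀
      rw [norm_smul, norm_inv, Real.norm_of_nonneg h1a.le, inv_mul_le_iff₀ h1a]
      refine le_of_sq_le_sq ?_ (by positivity)
      rw [hnorm]
      calc w ^ 2 * sqNorm (p - c - s • f) ≤ w ^ 2 * ((1 - a) * 0.4226) ^ 2 := by gcongr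
        _ = ((1 - a) * (w * 0.4226)) ^ 2 := by ring
    have e : (a • (y + (1 / 2 : ℝ) • a⁻¹ • Φ f) + (1 - a) • z₀ - Φ c) + Φ p =
        a • (y + (1 / 2 + s) • a⁻¹ • Φ f) + (1 - a) • (z₀ + (1 - a)⁻¹ • Φ (p - c - s • f)) := by
      rw [smul_add (1 - a), smul_inv_smul₀ h1a.ne', smul_add a, smul_add a,
        smul_comm (1 / 2 : ℝ) a⁻¹, smul_comm (1 / 2 + s) a⁻¹, smul_inv_smul₀ ha0.ne',
        smul_inv_smul₀ ha0.ne', map_sub, map_sub, map_smul]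
      module
    rw [e]
    exact hconv m1 m2 ha0.le h1a.le (by ring)
  exact ⟨_, key _ _ ho, fun i hi => key _ _ (ht i hi)⟩

/-! ### Concentric hexagons around two sets -/

/-- The frame with first vector `(cos θ, sin θ)`. -/
noncomputable def rotatedFrame (θ : ℝ) : Fin 3 → Plane :=
  ![!₂[Real.cos θ, Real.sin θ],
    !₂[-(Real.cos θ) / 2 - √3 / 2 * Real.sin θ, √3 / 2 * Real.cos θ - Real.sin θ / 2],
    !₂[-(Real.cos θ) / 2 + √3 / 2 * Real.sin θ, -(√3 / 2 * Real.cos θ) - Real.sin θ / 2]]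

theorem isFrame_rotatedFrame (θ : ℝ) : IsFrame (rotatedFrame θ) where
  norm_eq_one := by
    have h3 : √3 ^ 2 = 3 := Real.sq_sqrt (by norm_num)
    have hcs := Real.cos_sq_add_sin_sq θ
    have hnorm : ∀ a b : ℝ, a ^ 2 + b ^ 2 = 1 → ‖(!₂[a, b] : Plane)‖ = 1 := by
      intro a b h
      rw [EuclideanSpace.norm_eq, Fin.sum_univ_two]
      simp [h]
    refine forall_fin_three (hnorm _ _ hcs) (hnorm _ _ ?_) (hnorm _ _ ?_)
    · linear_combination hcs + (Real.cos θ ^ 2 + Real.sin θ ^ 2) / 4 * h3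
    · linear_combination hcs + (Real.cos θ ^ 2 + Real.sin θ ^ 2) / 4 * h3
  sum_eq_zero := by
    ext i
    fin_cases i <;> simp [rotatedFrame] <;> ring

theorem continuous_rotatedFrame (j : Fin 3) : Continuous fun θ => rotatedFrame θ j := by
  fin_cases j <;> simp only [rotatedFrame] <;>
  · refine (PiLp.continuous_toLp 2 _).comp (continuous_pi fun i => ?_)
    fin_cases i <;> simp <;> fun_prop

theorem rotatedFrame_add_pi (θ : ℝ) (j : Fin 3) :
    rotatedFrame (θ + Real.pi) j = -rotatedFrame θ j := by
  ext i
  fin_cases j <;> fin_cases i <;> simp [rotatedFrame] <;> ring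

/-- The sum of the odd part of `g` over a rotating frame changes sign under a half-turn. -/
theorem exists_frame_sum_eq_zero {g : Plane → ℝ} (hg : Continuous g) :
    ∃ u, IsFrame u ∧ ∑ j, (g (u j) - g (-u j)) = 0 := by
  set f : ℝ → ℝ := fun θ => ∑ j, (g (rotatedFrame θ j) - g (-rotatedFrame θ j)) with hf
  have hfc : Continuous f := continuous_finsetSum _ fun j _ =>
    (hg.comp (continuous_rotatedFrame j)).sub (hg.comp (continuous_rotatedFrame j).neg)
  have hodd : f (0 + Real.pi) = -f 0 := by
    simp only [hf, rotatedFrame_add_pi, neg_neg, ← Finset.sum_neg_distrib, neg_sub]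
  obtain ⟨θ, hθ⟩ : ∃ θ, f θ = 0 := by
    rcases le_total (f 0) 0 with h | h
    · exact mem_range_of_exists_le_of_exists_ge hfc ⟨0, h⟩ ⟨0 + Real.pi, by linarith⟩
    · exact mem_range_of_exists_le_of_exists_ge hfc ⟨0 + Real.pi, by linarith⟩ ⟨0, h⟩
  exact ⟨rotatedFrame θ, isFrame_rotatedFrame θ, hθ⟩

/-- The support function of a finite set. -/
noncomputable def supportFun (X : Finset Plane) (hX : X.Nonempty) (u : Plane) : ℝ :=
  X.sup' hX fun x => ⟪u, x⟫

theorem continuous_supportFun (X : Finset Plane) (hX : X.Nonempty) :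
    Continuous (supportFun X hX) :=
  Continuous.finset_sup'_apply hX fun x _ => by fun_prop

/-- If all distances between points of `X` and points of `Y` are at most `R`, then `X` and `Y` lie
in hexagons with common centre and parallel sides, whose corresponding half-widths `R / 2 + e j`
and `R / 2 - e j` add up to `R`. -/
theorem exists_concentric_hexagons {X Y : Finset Plane} (hX : X.Nonempty) (hY : Y.Nonempty) {R : ℝ}
    (hXY : ∀ x ∈ X, ∀ y ∈ Y, ‖x - y‖ ≤ R) :
    ∃ u, IsFrame u ∧ ∃ (p : Plane) (e : Fin 3 → ℝ),
      (∀ x ∈ X, ∀ j, |⟪u j, p - x⟫| ≤ R / 2 + e j) ∧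
      ∀ y ∈ Y, ∀ j, |⟪u j, p - y⟫| ≤ R / 2 - e j := by
  set g : Plane → ℝ := fun u => (supportFun X hX u - supportFun Y hY (-u)) / 2 with hg
  have hgc : Continuous g := by
    have h1 := continuous_supportFun X hX
    have h2 := (continuous_supportFun Y hY).comp continuous_neg
    exact (h1.sub h2).div_const 2
  obtain ⟨u, hu, hsum⟩ := exists_frame_sum_eq_zero hgc
  have hXY' : ∀ v : Plane, ‖v‖ = 1 → supportFun X hX v + supportFun Y hY (-v) ≤ R := by
    intro v hv
    obtain ⟨x, hx, hxe⟩ := X.exists_mem_eq_sup' hX fun x => ⟪v, x⟫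
    obtain ⟨y, hy, hye⟩ := Y.exists_mem_eq_sup' hY fun x => ⟪-v, x⟫
    rw [supportFun, supportFun, hxe, hye, inner_neg_left, ← sub_eq_add_neg, ← inner_sub_right]
    calc ⟪v, x - y⟫ ≤ ‖v‖ * ‖x - y‖ := real_inner_le_norm _ _
      _ ≤ R := by rw [hv, one_mul]; exact hXY x hx y hy
  have hXle : ∀ x ∈ X, ∀ v : Plane, ‖v‖ = 1 → ⟪v, x⟫ ≤ R / 2 + g v := by
    intro x hx v hv
    have h1 : ⟪v, x⟫ ≤ supportFun X hX v := X.le_sup' (fun x => ⟪v, x⟫) hx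
    have h2 := hXY' v hv
    simp only [hg]
    linarith
  have hYle : ∀ y ∈ Y, ∀ v : Plane, ‖v‖ = 1 → ⟪v, y⟫ ≤ R / 2 - g (-v) := by
    intro y hy v hv
    have h1 : ⟪v, y⟫ ≤ supportFun Y hY v := Y.le_sup' (fun x => ⟪v, x⟫) hy
    have h2 := hXY' (-v) (by rwa [norm_neg])
    simp only [hg]
    rw [neg_neg] at *
    linarith
  -- The odd parts of `g` at the frame vectors have sum zero, hence are the coordinates of a point.
  set o : Fin 3 → ℝ := fun j => (g (u j) - g (-u j)) / 2 with ho
  have hosum : o 0 + o 1 + o 2 = 0 := by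
    rw [Fin.sum_univ_three] at hsum
    simp only [ho]
    linarith
  set p := coordMap u (o 0, o 1) with hp
  have n0 : ⟪u 0, u 0⟫ = (1 : ℝ) := by rw [real_inner_self_eq_norm_sq, hu.norm_eq_one]; norm_num
  have n1 : ⟪u 1, u 1⟫ = (1 : ℝ) := by rw [real_inner_self_eq_norm_sq, hu.norm_eq_one]; norm_num
  have n10 : ⟪u 1, u 0⟫ = -(1 / 2 : ℝ) := by rw [real_inner_comm]; exact hu.inner_eq
  have hp0 : ⟪u 0, p⟫ = o 0 := by
    rw [hp, coordMap_apply, inner_smul_right, inner_add_right, inner_smul_right,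
      inner_smul_right, n0, hu.inner_eq]
    ring
  have hp1 : ⟪u 1, p⟫ = o 1 := by
    rw [hp, coordMap_apply, inner_smul_right, inner_add_right, inner_smul_right,
      inner_smul_right, n1, n10]
    ring
  have hp2 : ⟪u 2, p⟫ = o 2 := by
    have h2 : u 2 = -u 0 - u 1 := by
      have := hu.sum_eq_zero
      rw [← sub_eq_zero, ← this]
      abel
    rw [h2, inner_sub_left, inner_neg_left, hp0, hp1]
    linarith
  have hpo : ∀ j, ⟪u j, p⟫ = o j := forall_fin_three hp0 hp1 hp2
  refine ⟨u, hu, p, fun j => (g (u j) + g (-u j)) / 2, fun x hx j => ?_, fun y hy j => ?_⟩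
  · have h1 := hXle x hx (u j) (hu.norm_eq_one j)
    have h2 := hXle x hx (-u j) (by rw [norm_neg]; exact hu.norm_eq_one j)
    rw [inner_neg_left] at h2
    rw [abs_le, inner_sub_right, hpo]
    simp only [ho]
    constructor <;> linarith
  · have h1 := hYle y hy (u j) (hu.norm_eq_one j)
    have h2 := hYle y hy (-u j) (by rw [norm_neg]; exact hu.norm_eq_one j)
    rw [inner_neg_left, neg_neg] at h2
    rw [abs_le, inner_sub_right, hpo]
    simp only [ho]
    constructor <;> linarith

/-! ### Piercing translates -/

/-- Sorting the half-widths and rescaling reduces the covering of a hexagon with half-widths of sum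
at most `3 R / 2` to `exists_cover_of_antitone`. -/
theorem exists_cover_of_hexagon {K : Set Plane} (hK : Convex ℝ K) {R : ℝ} (hR : 0 < R)
    (hfit : ∀ u, IsFrame u → ∀ S I, HexStar.IsSmall S I → S.Fits K (R • coordMap u) I)
    {X : Finset Plane} (hX : X.Nonempty) {u : Fin 3 → Plane} (hu : IsFrame u) {p : Plane}
    {b : Fin 3 → ℝ} (hb : ∑ j, b j ≤ 3 / 2 * R) (hXb : ∀ x ∈ X, ∀ j, |⟪u j, p - x⟫| ≤ b j) :
    ∃ q : Fin 3 → Plane, ∀ x ∈ X, ∃ n, q n - x ∈ K := by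
  set σ := Tuple.sort fun j => -b j with hσ
  have hmono : Monotone ((fun j => -b j) ∘ σ) := Tuple.monotone_sort _
  have hanti : ∀ i j, i ≤ j → b (σ j) ≤ b (σ i) := fun i j hij => neg_le_neg_iff.1 (hmono hij)
  have hb0 : ∀ j, 0 ≤ b j := by
    obtain ⟨x, hx⟩ := hX
    exact fun j => (abs_nonneg _).trans (hXb x hx j)
  have hv := hu.comp_perm σ
  have hsum : b (σ 0) + b (σ 1) + b (σ 2) ≤ 3 / 2 * R := by
    rw [← Equiv.sum_comp σ b, Fin.sum_univ_three] at hb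
    exact hb
  obtain ⟨z, hz⟩ := exists_cover_of_antitone hK (hfit _ hv) (b := fun j => b (σ j) / R)
    (div_nonneg (hb0 _) hR.le) (by gcongr; exact hanti _ _ (by decide))
    (by gcongr; exact hanti _ _ (by decide))
    (by rw [← add_div, ← add_div, div_le_iff₀ hR]; exact hsum)
  refine ⟨fun n => z n + p, fun x hx => ?_⟩
  have hcoord : ∀ j, |⟪u (σ j), p - x⟫ / R| ≤ b (σ j) / R := by
    intro j
    rw [abs_div, abs_of_pos hR]
    gcongr
    exact hXb x hx _
  obtain ⟨n, hn⟩ := hz (⟪u (σ 0), p - x⟫ / R, ⟪u (σ 1), p - x⟫ / R) (hcoord 0) (hcoord 1) (by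
    have h2 : u (σ 0) + u (σ 1) = -u (σ 2) := eq_neg_of_add_eq_zero_left hv.sum_eq_zero
    simp only
    rw [← add_div, ← inner_add_left, h2, inner_neg_left, neg_div, abs_neg]
    exact hcoord 2)
  refine ⟨n, ?_⟩
  have e : (R • coordMap (u ∘ σ)) (⟪u (σ 0), p - x⟫ / R, ⟪u (σ 1), p - x⟫ / R) = p - x := by
    have h1 : ((⟪u (σ 0), p - x⟫ / R, ⟪u (σ 1), p - x⟫ / R) : ℝ × ℝ) =
        R⁻¹ • (⟪(u ∘ σ) 0, p - x⟫, ⟪(u ∘ σ) 1, p - x⟫) := by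
      simp [div_eq_inv_mul]
    rw [h1, LinearMap.smul_apply, map_smul, coordMap_inner hv, smul_inv_smul₀ hR.ne']
  rw [e] at hn
  rwa [add_sub_assoc]

/-- Of two sets with mutual distances at most `R`, one is covered by three translates of `-K`,
provided that `K` contains translates of all small pieces, scaled by `R`. -/
theorem exists_cover_or {K : Set Plane} (hK : Convex ℝ K) {R : ℝ} (hR : 0 < R)
    (hfit : ∀ u, IsFrame u → ∀ S I, HexStar.IsSmall S I → S.Fits K (R • coordMap u) I)
    {X Y : Finset Plane} (hX : X.Nonempty) (hY : Y.Nonempty)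
    (hXY : ∀ x ∈ X, ∀ y ∈ Y, ‖x - y‖ ≤ R) :
    (∃ q : Fin 3 → Plane, ∀ x ∈ X, ∃ n, q n - x ∈ K) ∨
      ∃ q : Fin 3 → Plane, ∀ y ∈ Y, ∃ n, q n - y ∈ K := by
  obtain ⟨u, hu, p, e, hXe, hYe⟩ := exists_concentric_hexagons hX hY hXY
  rcases le_total (∑ j, e j) 0 with h | h
  · refine Or.inl (exists_cover_of_hexagon hK hR hfit hX hu ?_ hXe)
    rw [Finset.sum_add_distrib, Fin.sum_const]
    simp only [nsmul_eq_mul, Nat.cast_ofNat]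
    linarith
  · refine Or.inr (exists_cover_of_hexagon hK hR hfit hY hu ?_ hYe)
    rw [Finset.sum_sub_distrib, Fin.sum_const]
    simp only [nsmul_eq_mul, Nat.cast_ofNat]
    linarith

theorem exists_cover_of_constantWidth {K : Set Plane} (hKc : IsCompact K) (hKn : K.Nonempty)
    (hK : Convex ℝ K) (hw : HasConstantWidth K) {X Y : Finset Plane} (hX : X.Nonempty)
    (hY : Y.Nonempty) (hXY : ∀ x ∈ X, ∀ y ∈ Y, ∃ a ∈ K, ∃ b ∈ K, x - y = a - b) :
    (∃ q : Fin 3 → Plane, ∀ x ∈ X, ∃ n, q n - x ∈ K) ∨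
      ∃ q : Fin 3 → Plane, ∀ y ∈ Y, ∃ n, q n - y ∈ K := by
  obtain ⟨w, hw⟩ := hw
  have hw0 := width_nonneg hKc hKn hw
  have hle : ∀ x ∈ X, ∀ y ∈ Y, ‖x - y‖ ≤ w := by
    intro x hx y hy
    obtain ⟨a, ha, b, hb, hab⟩ := hXY x hx y hy
    rw [hab]
    exact norm_sub_le_of_widthIn hKc hw ha hb hw0
  rcases hw0.eq_or_lt with rfl | hpos
  · -- If the width is zero, then `X` and `Y` consist of the same single point.
    obtain ⟨y, hy⟩ := hY
    obtain ⟨k, hk⟩ := hKn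
    refine Or.inl ⟨fun _ => y + k, fun x hx => ⟨0, ?_⟩⟩
    have : x = y := sub_eq_zero.1 (norm_le_zero_iff.1 (hle x hx y hy))
    rw [this]
    simpa using hk
  · exact exists_cover_or hK hpos
      (fun u hu S I hS => hS.fits_of_constantWidth hKc hKn hK hw hu) hX hY hle

/-- The normalised form of the second case: `K` lies between the unit disk and a disk of radius at
most `1.118 ≤ √5 / 2`. -/
theorem exists_cover_of_closedBall_subset {K : Set Plane} (hK : Convex ℝ K) {c : ℝ}
    (hc : c ≤ 1.118) {y : Plane} (hKD : unitDisk ⊆ K)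
    (hDK : K ⊆ AffineMap.homothety y c '' unitDisk) (hc1 : 1 ≤ c) {X Y : Finset Plane}
    (hX : X.Nonempty) (hY : Y.Nonempty)
    (hXY : ∀ x ∈ X, ∀ y ∈ Y, ∃ a ∈ K, ∃ b ∈ K, x - y = a - b) :
    (∃ q : Fin 3 → Plane, ∀ x ∈ X, ∃ n, q n - x ∈ K) ∨
      ∃ q : Fin 3 → Plane, ∀ y ∈ Y, ∃ n, q n - y ∈ K := by
  have h5 : (2.236 : ℝ) ≤ √5 := Real.le_sqrt_of_sq_le (by norm_num)
  refine exists_cover_or hK (R := √5) (by positivity)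
    (fun u hu S I hS => hS.fits_of_disk (z₀ := 0) (fun v hv => ?_) hu) hX hY ?_
  · rw [Real.sq_sqrt (by norm_num)] at hv
    rw [zero_add]
    apply hKD
    rw [unitDisk, mem_closedBall_zero_iff]
    nlinarith [norm_nonneg v]
  · intro x hx y' hy'
    obtain ⟨a, ha, b, hb, hab⟩ := hXY x hx y' hy'
    obtain ⟨a', ha', rfl⟩ := hDK ha
    obtain ⟨b', hb', rfl⟩ := hDK hb
    rw [unitDisk, mem_closedBall_zero_iff] at ha' hb'
    have e : x - y' = c • (a' - b') := by
      rw [hab, AffineMap.homothety_apply, AffineMap.homothety_apply]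
      simp only [vsub_eq_sub, vadd_eq_add]
      module
    rw [e, norm_smul, Real.norm_of_nonneg (by linarith)]
    have := norm_sub_le a' b'
    nlinarith [norm_nonneg (a' - b')]

/-- The infimum in the Banach-Mazur distance need not be attained, but it is less than `1.118`. -/
theorem exists_cover_of_banachMazurDist {K : Set Plane} (hK : Convex ℝ K)
    (hd : banachMazurDist K unitDisk ≤ ENNReal.ofReal 1.1178) {X Y : Finset Plane}
    (hX : X.Nonempty) (hY : Y.Nonempty)
    (hXY : ∀ x ∈ X, ∀ y ∈ Y, ∃ a ∈ K, ∃ b ∈ K, x - y = a - b) :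
    (∃ q : Fin 3 → Plane, ∀ x ∈ X, ∃ n, q n - x ∈ K) ∨
      ∃ q : Fin 3 → Plane, ∀ y ∈ Y, ∃ n, q n - y ∈ K := by
  have hlt : banachMazurDist K unitDisk < ENNReal.ofReal 1.118 :=
    hd.trans_lt ((ENNReal.ofReal_lt_ofReal_iff (by norm_num)).2 (by norm_num))
  simp only [banachMazurDist, iInf_lt_iff] at hlt
  obtain ⟨c, ⟨hc1, T, y, hDT, hTD⟩, hc⟩ := hlt
  have hc' : c ≤ 1.118 := ((ENNReal.ofReal_lt_ofReal_iff (by norm_num)).1 hc).le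
  classical
  have hlin : ∀ a b, T a - T b = T.linear (a - b) :=
    fun a b => (T.toAffineMap.linearMap_vsub a b).symm
  -- Pull a cover of the image under the linear part of `T` back to the original set.
  have hback : ∀ X : Finset Plane, (∃ q : Fin 3 → Plane, ∀ x ∈ X.image T.linear,
      ∃ n, q n - x ∈ T '' K) → ∃ q : Fin 3 → Plane, ∀ x ∈ X, ∃ n, q n - x ∈ K := by
    rintro X ⟨q, hq⟩
    refine ⟨fun n => T.symm (q n), fun x hx => ?_⟩
    obtain ⟨n, k, hk, hkx⟩ := hq _ (Finset.mem_image_of_mem _ hx)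
    refine ⟨n, ?_⟩
    have : T.symm (q n) - x = k := by
      apply T.injective
      have h1 := hlin (T.symm (q n)) (T.symm (q n) - x)
      rw [sub_sub_cancel, T.apply_symm_apply] at h1
      rw [hkx, ← h1]
      abel
    rwa [this]
  have hTK : Convex ℝ (T '' K) := hK.affine_image T.toAffineMap
  rcases exists_cover_of_closedBall_subset hTK hc' hDT hTD hc1 (hX.image T.linear)
    (hY.image T.linear) (by
      intro x' hx' y' hy'
      obtain ⟨x, hx, rfl⟩ := Finset.mem_image.1 hx'
      obtain ⟨y, hy, rfl⟩ := Finset.mem_image.1 hy'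
      obtain ⟨a, ha, b, hb, hab⟩ := hXY x hx y hy
      exact ⟨T a, Set.mem_image_of_mem _ ha, T b, Set.mem_image_of_mem _ hb, by
        rw [hlin, ← map_sub, hab]⟩) with h | h
  · exact Or.inl (hback X h)
  · exact Or.inr (hback Y h)

theorem mainTheorem1 (K : ConvexBody Plane)
    (hK : HasConstantWidth (K : Set Plane) ∨
      banachMazurDist (K : Set Plane) unitDisk ≤ ENNReal.ofReal 1.1178)
    (F₁ F₂ : Set (Set Plane)) (hfin₁ : F₁.Finite) (hfin₂ : F₂.Finite)
    (htrans₁ : IsFamilyOfTranslates F₁ (K : Set Plane))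
    (htrans₂ : IsFamilyOfTranslates F₂ (K : Set Plane))
    (hmeet : ∀ A ∈ F₁, ∀ B ∈ F₂, (A ∩ B).Nonempty) :
    CanBePierced F₁ 3 ∨ CanBePierced F₂ 3 := by
  classical
  rcases F₁.eq_empty_or_nonempty with rfl | hne₁
  · exact Or.inl ⟨∅, by simp, by simp⟩
  rcases F₂.eq_empty_or_nonempty with rfl | hne₂
  · exact Or.inr ⟨∅, by simp, by simp⟩
  choose! t₁ ht₁ using htrans₁
  choose! t₂ ht₂ using htrans₂
  have hpierce : ∀ (F : Set (Set Plane)) (hF : F.Finite) (t : Set Plane → Plane),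
      (∀ A ∈ F, A = t A +ᵥ (K : Set Plane)) →
      (∃ q : Fin 3 → Plane, ∀ x ∈ hF.toFinset.image t, ∃ n, q n - x ∈ (K : Set Plane)) →
      CanBePierced F 3 := by
    rintro F hF t ht ⟨q, hq⟩
    refine ⟨Finset.univ.image q, Finset.card_image_le.trans (by simp), fun A hA => ?_⟩
    obtain ⟨n, hn⟩ := hq _ (Finset.mem_image_of_mem t (hF.mem_toFinset.2 hA))
    refine ⟨q n, Finset.mem_image_of_mem q (Finset.mem_univ n), ?_⟩
    rw [ht A hA, Set.mem_vadd_set_iff_neg_vadd_mem, vadd_eq_add, neg_add_eq_sub]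
    exact hn
  have hXY : ∀ x ∈ hfin₁.toFinset.image t₁, ∀ y ∈ hfin₂.toFinset.image t₂,
      ∃ a ∈ (K : Set Plane), ∃ b ∈ (K : Set Plane), x - y = a - b := by
    intro x hx y hy
    obtain ⟨A, hA, rfl⟩ := Finset.mem_image.1 hx
    obtain ⟨B, hB, rfl⟩ := Finset.mem_image.1 hy
    rw [Set.Finite.mem_toFinset] at hA hB
    obtain ⟨p, hpA, hpB⟩ := hmeet A hA B hB
    rw [ht₁ A hA] at hpA
    rw [ht₂ B hB] at hpB
    obtain ⟨b, hb, hbe⟩ := hpA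
    obtain ⟨a, ha, hae⟩ := hpB
    refine ⟨a, ha, b, hb, ?_⟩
    simp only [vadd_eq_add] at hbe hae
    rw [sub_eq_sub_iff_add_eq_add, hbe, add_comm a, hae]
  have hX : (hfin₁.toFinset.image t₁).Nonempty := by simpa using hne₁
  have hY : (hfin₂.toFinset.image t₂).Nonempty := by simpa using hne₂
  have hcover := hK.elim
    (fun h => exists_cover_of_constantWidth K.isCompact K.nonempty K.convex h hX hY hXY)
    (fun h => exists_cover_of_banachMazurDist K.convex h hX hY hXY)
  exact hcover.imp (hpierce F₁ hfin₁ t₁ ht₁) (hpierce F₂ hfin₂ t₂ ht₂)
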